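/- **Setting.** A battery has interval length $T>0$, energy capacity $E>0$, power rating $P>0$, cell replacement price $R>0$, charge and discharge efficiencies $\eta_c,\eta_d>0$, and energy limits $\underline e\le\overline e$ with $\overline e-\underline e\le E$. Penalty prices are $\theta,\pi\ge 0$. The cycle stress function $\Phi:[0,1]\to[0,\infty)$ is strictly convex with $\Phi(0)=0$. Controls $(c_n,d_n)_{n<N}$ move the stored energy by $e_{n+1}=e_n+T\eta_c c_n-(T/\eta_d)d_n$. They are *feasible* from $e_0$ if $\underline e\le e_n\le\overline e$ for all $n\le N$ and, for all $n<N$, $0\le c_n\le P$, $0\le d_n\le P$, and $c_n=0$ or $d_n=0$. Given instructions $r_n\in[-P,P]$ (positive means charge), they *respond within the instruction* if moreover $c_n\le[r_n]^+$ and $d_n\le[-r_n]^+$. The cost is $J(c,d,r)=ER\,\Delta L+T\theta\sum_n[r_n-c_n+d_n]^+ +T\pi\sum_n[c_n-d_n-r_n]^+$. Here $\Delta L=\sum_i\Phi(u_i)+\tfrac12\sum_i\Phi(v_i)+\tfrac12\sum_i\Phi(w_i)$, where $u_i,v_i,w_i$ are the depths of the full cycles, charge half cycles and discharge half cycles that rainflow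 counting finds in the profile $(e_n-e_0)/E$. Rainflow counting works on the list of local extrema (end points included): for consecutive points $s_1,s_2,s_3,s_4$ with $|s_2-s_3|\le|s_1-s_2|$ and $|s_2-s_3|\le|s_3-s_4|$ it records a full cycle of depth $|s_2-s_3|$ and deletes $s_2,s_3$; otherwise it moves forward one point; this is repeated until no such four points remain. Each step between adjacent points of what remains is a half cycle, charge if increasing and discharge if decreasing. Put $$J_u(x)=ER\,\Phi(x)-E(\theta/\eta_c+\pi\eta_d)x,\quad J_v(x)=\tfrac12ER\,\Phi(x)-\tfrac{E}{\eta_c}\theta x,\quad J_w(x)=\tfrac12ER\,\Phi(x)-E\eta_d\pi x,$$ and let $\hat u,\hat v,\hat w$ be their minimizers on the domain $[0,1]$ of $\Phi$. The threshold policy $g$, started at $e_0$, keeps the running maximum $e^{\max}_n$ and minimum $e^{\min}_n$ of $e_0,\dots,e_n$. If $r_n\ge0$ it sets $d_n=0$ and $c_n=\min\{\frac1{T\eta_c}(\min\{\overline e,e^{\min}_n+\hat uE\}-e_n),\,r_n\}$. If $r_n<0$ it sets $c_n=0$ and $d_n=\min\{\frac{\eta_d}{T}(e_n-\max\{\underline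 e,e^{\max}_n-\hat uE\}),\,-r_n\}$. **Theorem 2.** Let $$\varepsilon=\begin{cases}J_w(\hat u)+2J_v(\hat u)-J_w(\hat w)-2J_v(\hat v)&\text{if }\pi\eta_d>\theta/\eta_c,\\ 0&\text{if }\pi\eta_d=\theta/\eta_c,\\ 2J_w(\hat u)+J_v(\hat u)-2J_w(\hat w)-J_v(\hat v)&\text{if }\pi\eta_d<\theta/\eta_c.\end{cases}$$ 1. For every $N\in\mathbb N$, every $e_0\in[\underline e,\overline e]$, every $r\in[-P,P]^N$ and every feasible $(c,d)$ that responds within the instruction, $J(g(e_0,r),r)-J(c,d,r)\le\varepsilon$. 2. Suppose $\pi\eta_d=\theta/\eta_c$, or the energy range is wide enough that $(\hat u+|\hat w-\hat v|)E\le\overline e-\underline e$. Then $\varepsilon$ is exactly the worst-case optimality gap: it is the maximum of $J(g(e_0,r),r)-J(c^*,d^*,r)$ over all $N$, all $e_0\in[\underline e,\overline e]$, all $r\in[-P,P]^N$, and all offline minimizers $(c^*,d^*)$ of $J(\cdot,\cdot,r)$ among the feasible controls that respond within the instruction. 3. If $\eta_c\eta_d=1$ (no losses), then 1 and 2 also hold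 with all feasible controls in place of those that respond within the instruction. -/

import Mathlib

noncomputable section

namespace BatteryRegulation

/-! ### Rainflow cycle counting -/

/-- The successive local extrema of a profile (its first and last points included). A point lying
between its two neighbours is not an extremum, and repeated values are merged. -/
def localExtrema : List ℝ → List ℝ
  | [] => []
  | [a] => [a]
  | [a, b] => if a = b then [a] else [a, b]
  | a :: b :: c :: l =>
      if (a ≤ b ∧ b ≤ c) ∨ (c ≤ b ∧ b ≤ a) then localExtrema (a :: c :: l)
      else a :: localExtrema (b :: c :: l)
termination_by l => l.length

/-- One forward sweep of the rainflow procedure over a list of extrema. Looking at four consecutive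
points `s₁ s₂ s₃ s₄`, if `|s₂ - s₃|` is at most `|s₁ - s₂|` and at most `|s₃ - s₄|`, a full cycle of
depth `|s₂ - s₃|` is recorded and `s₂, s₃` are removed; otherwise the window moves forward by one
point. Returns the depths recorded and the remaining profile. -/
def rainflowSweep : List ℝ → List ℝ × List ℝ
  | s₁ :: s₂ :: s₃ :: s₄ :: l =>
      if |s₂ - s₃| ≤ |s₁ - s₂| ∧ |s₂ - s₃| ≤ |s₃ - s₄| then
        let q := rainflowSweep (s₁ :: s₄ :: l)
        (|s₂ - s₃| :: q.1, q.2)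
      else
        let q := rainflowSweep (s₂ :: s₃ :: s₄ :: l)
        (q.1, s₁ :: q.2)
  | l => ([], l)
termination_by l => l.length

/-- `k` successive sweeps: all full-cycle depths recorded, and the profile that remains. -/
def rainflowSweeps : ℕ → List ℝ → List ℝ × List ℝ
  | 0, l => ([], l)
  | k + 1, l =>
      let q := rainflowSweep l
      let q' := rainflowSweeps k q.2
      (q.1 ++ q'.1, q'.2)

/-- Depths of the charge (increasing) half cycles between adjacent points of a residue. -/
def chargeHalfCycles : List ℝ → List ℝ
  | a :: b :: l => if a < b then (b - a) :: chargeHalfCycles (b :: l) else chargeHalfCycles (b :: l)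
  | _ => []

/-- Depths of the discharge (decreasing) half cycles between adjacent points of a residue. -/
def dischargeHalfCycles : List ℝ → List ℝ
  | a :: b :: l =>
      if b < a then (a - b) :: dischargeHalfCycles (b :: l) else dischargeHalfCycles (b :: l)
  | _ => []

/-- The result of cycle counting: depths of full cycles, charge half cycles, discharge half cycles. -/
structure Cycles where
  full : List ℝ
  charge : List ℝ
  discharge : List ℝ

/-- Rainflow counting of a profile, with the residue decomposed into half cycles. A sweep that
records a cycle shortens the profile, and a sweep that records none leaves it unchanged, so as many
sweeps as there are points exhaust all full cycles. -/
def rainflow (profile : List ℝ) : Cycles :=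
  let s := localExtrema profile
  let q := rainflowSweeps s.length s
  { full := q.1
    charge := chargeHalfCycles q.2
    discharge := dischargeHalfCycles q.2 }

/-- Total life loss: `Φ` of each full cycle plus half of `Φ` of each half cycle. -/
def lifeLoss (Φ : ℝ → ℝ) (y : Cycles) : ℝ :=
  (y.full.map Φ).sum + (y.charge.map fun v => Φ v / 2).sum + (y.discharge.map fun w => Φ w / 2).sum

/-! ### Battery, market and objective -/

/-- The data of the problem: interval length `T`, energy capacity `E`, replacement price `R`,
power rating `P`, charge and discharge efficiencies `ηc`, `ηd`, minimum and maximum energy levels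
`eLo`, `eHi`, penalty prices `θ` (surplus injection or deficient demand) and `π` (deficient
injection or surplus demand), and the cycle depth stress function `Φ` (used on `[0, 1]` only). -/
structure Model where
  T : ℝ
  E : ℝ
  R : ℝ
  P : ℝ
  ηc : ℝ
  ηd : ℝ
  eLo : ℝ
  eHi : ℝ
  θ : ℝ
  π : ℝ
  Φ : ℝ → ℝ

namespace Model

variable (M : Model)

/-- The stored energy after `n` intervals, starting from `e₀`, under charge controls `c` and
discharge controls `d`. -/
def soc (e₀ : ℝ) (c d : ℕ → ℝ) : ℕ → ℝ
  | 0 => e₀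
  | n + 1 => soc e₀ c d n + (M.T * M.ηc * c n - M.T / M.ηd * d n)

/-- The normalized profile over `N` intervals, as a list of `N + 1` points starting at `0`. -/
def profile (N : ℕ) (c d : ℕ → ℝ) : List ℝ :=
  (List.range (N + 1)).map fun n => M.soc 0 c d n / M.E

/-- Cycle aging cost. -/
def agingCost (N : ℕ) (c d : ℕ → ℝ) : ℝ :=
  lifeLoss M.Φ (rainflow (M.profile N c d)) * (M.E * M.R)

/-- Performance penalty; `r n > 0` is a charge instruction. -/
def penalty (N : ℕ) (c d r : ℕ → ℝ) : ℝ :=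
  M.T * M.θ * ∑ n ∈ Finset.range N, max (r n - c n + d n) 0 +
    M.T * M.π * ∑ n ∈ Finset.range N, max (c n - d n - r n) 0

/-- The total operating cost of a pair of control sequences `x = (c, d)`. -/
def cost (N : ℕ) (r : ℕ → ℝ) (x : (ℕ → ℝ) × (ℕ → ℝ)) : ℝ :=
  M.agingCost N x.1 x.2 + M.penalty N x.1 x.2 r

/-- Controls `(c, d)` satisfying the battery's operation constraints over `N` intervals. -/
def feasible (N : ℕ) (e₀ : ℝ) : Set ((ℕ → ℝ) × (ℕ → ℝ)) :=
  {x | (∀ n ≤ N, M.soc e₀ x.1 x.2 n ∈ Set.Icc M.eLo M.eHi) ∧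
    ∀ n < N, x.1 n ∈ Set.Icc 0 M.P ∧ x.2 n ∈ Set.Icc 0 M.P ∧ (x.1 n = 0 ∨ x.2 n = 0)}

/-- Feasible controls whose response never exceeds the regulation instruction:
`c n ≤ [r n]⁺` and `d n ≤ [-r n]⁺`. -/
def responsive (N : ℕ) (e₀ : ℝ) (r : ℕ → ℝ) : Set ((ℕ → ℝ) × (ℕ → ℝ)) :=
  {x | x ∈ M.feasible N e₀ ∧ ∀ n < N, x.1 n ≤ max (r n) 0 ∧ x.2 n ≤ max (-r n) 0}

/-! ### The threshold policy -/

/-- What the controller knows at an interval: the current energy level and its running maximum and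
minimum since the beginning of the operation. -/
structure PolicyState where
  e : ℝ
  eMax : ℝ
  eMin : ℝ

/-- The action `(c, d)` of the policy with depth threshold `u` in state `s` on instruction `ρ`. -/
def policyAction (u : ℝ) (s : PolicyState) (ρ : ℝ) : ℝ × ℝ :=
  if 0 ≤ ρ then
    (min (1 / (M.T * M.ηc) * (min M.eHi (s.eMin + u * M.E) - s.e)) ρ, 0)
  else
    (0, min (M.ηd / M.T * (s.e - max M.eLo (s.eMax - u * M.E))) (-ρ))

/-- The state of the controller at interval `n`. -/
def policyState (u e₀ : ℝ) (r : ℕ → ℝ) : ℕ → PolicyState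
  | 0 => ⟨e₀, e₀, e₀⟩
  | n + 1 =>
      let s := policyState u e₀ r n
      let a := M.policyAction u s (r n)
      let e' := s.e + (M.T * M.ηc * a.1 - M.T / M.ηd * a.2)
      ⟨e', max s.eMax e', min s.eMin e'⟩

/-- The controls `g(e₀, r)` produced by the threshold policy. -/
def policy (u e₀ : ℝ) (r : ℕ → ℝ) : (ℕ → ℝ) × (ℕ → ℝ) :=
  (fun n => (M.policyAction u (M.policyState u e₀ r n) (r n)).1,
    fun n => (M.policyAction u (M.policyState u e₀ r n) (r n)).2)

/-! ### Optimality gap -/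

/-- `ε` bounds the excess cost of the policy over every control in the class `A` (which depends on
horizon, initial level and instructions), for all horizons, initial levels and instructions. -/
def BoundsGap (u : ℝ) (A : ℕ → ℝ → (ℕ → ℝ) → Set ((ℕ → ℝ) × (ℕ → ℝ))) (ε : ℝ) : Prop :=
  ∀ (N : ℕ) (e₀ : ℝ) (r : ℕ → ℝ), e₀ ∈ Set.Icc M.eLo M.eHi →
    (∀ n < N, r n ∈ Set.Icc (-M.P) M.P) →
    ∀ x ∈ A N e₀ r, M.cost N r (M.policy u e₀ r) - M.cost N r x ≤ ε

/-- All optimality gaps `J(g(e₀, r), r) - J(c*, d*, r)`, where `(c*, d*)` is an offline minimizer of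
the cost over the class `A`. -/
def gaps (u : ℝ) (A : ℕ → ℝ → (ℕ → ℝ) → Set ((ℕ → ℝ) × (ℕ → ℝ))) : Set ℝ :=
  {δ | ∃ (N : ℕ) (e₀ : ℝ) (r : ℕ → ℝ) (x : (ℕ → ℝ) × (ℕ → ℝ)),
    e₀ ∈ Set.Icc M.eLo M.eHi ∧ (∀ n < N, r n ∈ Set.Icc (-M.P) M.P) ∧
    x ∈ A N e₀ r ∧ IsMinOn (M.cost N r) (A N e₀ r) x ∧
    δ = M.cost N r (M.policy u e₀ r) - M.cost N r x}

/-- Cost of a full cycle of depth `x`, up to a constant that does not depend on the controls. -/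
def Ju (x : ℝ) : ℝ := M.E * M.R * M.Φ x - M.E * (M.θ / M.ηc + M.π * M.ηd) * x

/-- Cost of a charge half cycle of depth `x`. -/
def Jv (x : ℝ) : ℝ := 1 / 2 * (M.E * M.R * M.Φ x) - M.E / M.ηc * M.θ * x

/-- Cost of a discharge half cycle of depth `x`. -/
def Jw (x : ℝ) : ℝ := 1 / 2 * (M.E * M.R * M.Φ x) - M.E * M.ηd * M.π * x

/-- The claimed worst-case optimality gap. -/
def worstGap (u v w : ℝ) : ℝ :=
  if M.θ / M.ηc < M.π * M.ηd then M.Jw u + 2 * M.Jv u - M.Jw w - 2 * M.Jv v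
  else if M.π * M.ηd < M.θ / M.ηc then 2 * M.Jw u + M.Jv u - 2 * M.Jw w - M.Jv v
  else 0

end Model

end BatteryRegulation

end

/-!
For each width `t`, the sum of `min x t` over the depths `x` of the downward strokes of the rainflow
count is the downward variation of the stop operator of width `t` started at the top of its window:
both sides lose the same amount when a cycle is removed, and they agree when no cycle is left. A
pointwise comparison shows that up to the optimal depth `u` the threshold path maximizes this
variation, for every `t ≤ u` simultaneously, among all admissible responses, and symmetrically for
upward strokes. The charge and discharge half-cycle prices are convex, so where they decrease they
are mixtures of truncations `min x t`, and the policy wins on the strokes whose price still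
decreases at `u`. In the other direction, full cycles cancel and the residue alternates, so for
every monotone weight the upward and downward strokes balance up to the weight of the largest depth.
This bounds what the policy can lose there by `2 (f u - f v) + (g u - g w)`, where `f` is the
half-cycle price with the smaller minimizer `v`, and `g` the other one, with minimizer `w`. The
bound is attained by a profile that goes up, down and up again, or by its mirror image.
-/

noncomputable section

namespace BatteryRegulation

/-! ### The stop operator -/

/-- The point of the window `[0, t]` nearest to `x`, for `0 ≤ t`. -/
def clampTo (t x : ℝ) : ℝ := max 0 (min x t)

/-- The downward variation of the stop (hysteresis) operator of width `t` along a profile: the room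
`B` left below the current point inside a window of width `t` follows the profile and is kept in
`[0, t]`. -/
def stopDown (t : ℝ) : ℝ → List ℝ → ℝ
  | B, a :: b :: l =>
      max (B - clampTo t (B + (b - a))) 0 + stopDown t (clampTo t (B + (b - a))) (b :: l)
  | _, _ => 0

section Clamp

variable {t B a b c s₁ s₂ s₃ s₄ : ℝ}

theorem clampTo_mem (ht : 0 ≤ t) (x : ℝ) : clampTo t x ∈ Set.Icc 0 t := by
  simp only [clampTo, Set.mem_Icc]; grind

theorem clampTo_add_mem (hB : B ∈ Set.Icc 0 t) (x : ℝ) : clampTo t (B + x) ∈ Set.Icc 0 t :=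
  clampTo_mem (hB.1.trans hB.2) _

theorem clampTo_clampTo_of_between (hB : B ∈ Set.Icc 0 t)
    (h : (a ≤ b ∧ b ≤ c) ∨ (c ≤ b ∧ b ≤ a)) :
    clampTo t (clampTo t (B + (b - a)) + (c - b)) = clampTo t (B + (c - a)) := by
  simp only [clampTo, Set.mem_Icc] at *; grind

theorem drop_add_drop_of_between (hB : B ∈ Set.Icc 0 t)
    (h : (a ≤ b ∧ b ≤ c) ∨ (c ≤ b ∧ b ≤ a)) :
    max (B - clampTo t (B + (b - a))) 0 +
        max (clampTo t (B + (b - a)) - clampTo t (B + (c - a))) 0 =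
      max (B - clampTo t (B + (c - a))) 0 := by
  simp only [clampTo, Set.mem_Icc] at *; grind

/-- Wiping-out property of hysteresis: an enclosed cycle leaves no trace in the state. -/
theorem clampTo_wipe_out (hB : B ∈ Set.Icc 0 t)
    (h : (s₁ ≤ s₃ ∧ s₃ ≤ s₂ ∧ s₂ ≤ s₄) ∨ (s₄ ≤ s₂ ∧ s₂ ≤ s₃ ∧ s₃ ≤ s₁)) :
    clampTo t (clampTo t (clampTo t (B + (s₂ - s₁)) + (s₃ - s₂)) + (s₄ - s₃)) =
      clampTo t (B + (s₄ - s₁)) := by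
  simp only [clampTo, Set.mem_Icc] at *; grind

theorem drop_wipe_out (hB : B ∈ Set.Icc 0 t)
    (h : (s₁ ≤ s₃ ∧ s₃ ≤ s₂ ∧ s₂ ≤ s₄) ∨ (s₄ ≤ s₂ ∧ s₂ ≤ s₃ ∧ s₃ ≤ s₁)) :
    max (B - clampTo t (B + (s₂ - s₁))) 0 +
        (max (clampTo t (B + (s₂ - s₁)) - clampTo t (clampTo t (B + (s₂ - s₁)) + (s₃ - s₂))) 0 +
          max (clampTo t (clampTo t (B + (s₂ - s₁)) + (s₃ - s₂)) - clampTo t (B + (s₄ - s₁))) 0) =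
      min |s₂ - s₃| t + max (B - clampTo t (B + (s₄ - s₁))) 0 := by
  rcases h with h | h
  · rw [abs_of_nonneg (by linarith)]
    simp only [clampTo, Set.mem_Icc] at *; grind
  · rw [abs_of_nonpos (by linarith)]
    simp only [clampTo, Set.mem_Icc] at *; grind

theorem stopDown_between (hB : B ∈ Set.Icc 0 t) (h : (a ≤ b ∧ b ≤ c) ∨ (c ≤ b ∧ b ≤ a))
    (l : List ℝ) : stopDown t B (a :: b :: c :: l) = stopDown t B (a :: c :: l) := by
  simp only [stopDown]
  rw [clampTo_clampTo_of_between hB h, ← add_assoc, drop_add_drop_of_between hB h]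

theorem stopDown_wipe_out (hB : B ∈ Set.Icc 0 t)
    (h : (s₁ ≤ s₃ ∧ s₃ ≤ s₂ ∧ s₂ ≤ s₄) ∨ (s₄ ≤ s₂ ∧ s₂ ≤ s₃ ∧ s₃ ≤ s₁)) (l : List ℝ) :
    stopDown t B (s₁ :: s₂ :: s₃ :: s₄ :: l) =
      min |s₂ - s₃| t + stopDown t B (s₁ :: s₄ :: l) := by
  simp only [stopDown]
  rw [clampTo_wipe_out hB h]
  linarith [drop_wipe_out hB h]

end Clamp

/-! ### Local extrema -/

theorem head?_localExtrema (l : List ℝ) : (localExtrema l).head? = l.head? := by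
  induction l using localExtrema.induct <;> rw [localExtrema] <;> grind

theorem exists_localExtrema_cons (a : ℝ) (l : List ℝ) : ∃ m, localExtrema (a :: l) = a :: m :=
  List.head?_eq_some_iff.1 (head?_localExtrema (a :: l))

theorem localExtrema_subset (l : List ℝ) : localExtrema l ⊆ l := by
  induction l using localExtrema.induct <;> rw [localExtrema] <;> grind

theorem stopDown_cons_congr {t a b B : ℝ} {l m : List ℝ} (hl : l.head? = some b)
    (hm : m.head? = some b)
    (h : stopDown t (clampTo t (B + (b - a))) l = stopDown t (clampTo t (B + (b - a))) m) :
    stopDown t B (a :: l) = stopDown t B (a :: m) := by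
  obtain ⟨l, rfl⟩ := List.head?_eq_some_iff.1 hl
  obtain ⟨m, rfl⟩ := List.head?_eq_some_iff.1 hm
  rw [stopDown, stopDown, h]

theorem stopDown_localExtrema {t B : ℝ} (hB : B ∈ Set.Icc 0 t) (l : List ℝ) :
    stopDown t B (localExtrema l) = stopDown t B l := by
  induction l using localExtrema.induct generalizing B with
  | case1 => simp [localExtrema]
  | case2 => simp [localExtrema]
  | case3 a =>
    have : clampTo t B = B := by simp only [clampTo, Set.mem_Icc] at *; grind
    simp [localExtrema, stopDown, this]
  | case4 a b h => simp [localExtrema, h]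
  | case5 a b c l h ih => rw [localExtrema, if_pos h, ih hB, stopDown_between hB h]
  | case6 a b c l h ih =>
    rw [localExtrema, if_neg h]
    exact stopDown_cons_congr (head?_localExtrema _) rfl (ih (clampTo_add_mem hB _))

/-- A strictly alternating profile; the flag tells whether the first step is upward. -/
def Zigzag : Bool → List ℝ → Prop
  | σ, a :: b :: l => (if σ then a < b else b < a) ∧ Zigzag (!σ) (b :: l)
  | _, _ => True

theorem zigzag_localExtrema_of_ne {a b : ℝ} (hab : a ≠ b) (l : List ℝ) :
    Zigzag (decide (a < b)) (localExtrema (a :: b :: l)) := by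
  induction l generalizing a b with
  | nil =>
    have hba : b ≤ a → b < a := fun h => lt_of_le_of_ne h hab.symm
    simpa [localExtrema, hab, Zigzag] using hba
  | cons c l ih =>
    rw [localExtrema]
    split_ifs with h
    · have hac : a ≠ c := by grind
      have : (a < b) = (a < c) := by grind
      simpa only [this] using ih hac
    · have hbc : b ≠ c := by grind
      obtain ⟨m, hm⟩ := exists_localExtrema_cons b (c :: l)
      have hflag : decide (b < c) = !decide (a < b) := by grind
      rw [hm, Zigzag, ← hflag, ← hm]
      exact ⟨by grind, ih hbc⟩

theorem exists_zigzag_localExtrema (l : List ℝ) : ∃ σ, Zigzag σ (localExtrema l) := by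
  induction l using localExtrema.induct with
  | case1 => exact ⟨true, by simp [localExtrema, Zigzag]⟩
  | case2 => exact ⟨true, by simp [localExtrema, Zigzag]⟩
  | case3 => exact ⟨true, by simp [localExtrema, Zigzag]⟩
  | case4 a b h => exact ⟨_, zigzag_localExtrema_of_ne h _⟩
  | case5 a b c l h ih => rwa [localExtrema, if_pos h]
  | case6 a b c l h => exact ⟨_, zigzag_localExtrema_of_ne (by grind) _⟩

/-! ### Removing enclosed cycles -/

/-- `CycleRemoval l F m`: the profile `m` arises from `l` by successively deleting enclosed cycles,
whose depths are listed in `F`. -/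
inductive CycleRemoval : List ℝ → List ℝ → List ℝ → Prop
  | refl (l : List ℝ) : CycleRemoval l [] l
  | cycle {s₁ s₂ s₃ s₄ : ℝ} {l F m : List ℝ} (h₁ : |s₂ - s₃| ≤ |s₁ - s₂|)
      (h₂ : |s₂ - s₃| ≤ |s₃ - s₄|) (h : CycleRemoval (s₁ :: s₄ :: l) F m) :
      CycleRemoval (s₁ :: s₂ :: s₃ :: s₄ :: l) (|s₂ - s₃| :: F) m
  | cons {a b : ℝ} {l F m : List ℝ} (h : CycleRemoval (b :: l) F (b :: m)) :
      CycleRemoval (a :: b :: l) F (a :: b :: m)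
  | trans {l F m G k : List ℝ} (h : CycleRemoval l F m) (h' : CycleRemoval m G k) :
      CycleRemoval l (F ++ G) k

theorem CycleRemoval.head?_eq {l F m : List ℝ} (h : CycleRemoval l F m) : m.head? = l.head? := by
  induction h <;> simp_all

theorem cycleRemoval_rainflowSweep (l : List ℝ) :
    CycleRemoval l (rainflowSweep l).1 (rainflowSweep l).2 := by
  induction l using rainflowSweep.induct with
  | case1 s₁ s₂ s₃ s₄ l h ih => rw [rainflowSweep, if_pos h]; exact .cycle h.1 h.2 ih
  | case2 s₁ s₂ s₃ s₄ l h ih =>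
    obtain ⟨m, hm⟩ := List.head?_eq_some_iff.1 ih.head?_eq
    rw [rainflowSweep, if_neg h]
    simp only [hm] at ih ⊢
    exact .cons ih
  | case3 l h => rw [rainflowSweep.eq_2 _ h]; exact .refl l

theorem cycleRemoval_rainflowSweeps (k : ℕ) (l : List ℝ) :
    CycleRemoval l (rainflowSweeps k l).1 (rainflowSweeps k l).2 := by
  induction k generalizing l with
  | zero => exact .refl l
  | succ k ih => exact (cycleRemoval_rainflowSweep l).trans (ih _)

namespace CycleRemoval

variable {l F m : List ℝ}

theorem subset (h : CycleRemoval l F m) : m ⊆ l := by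
  induction h <;> grind

theorem exists_depth_eq (h : CycleRemoval l F m) {x : ℝ} (hx : x ∈ F) :
    ∃ p ∈ l, ∃ q ∈ l, x = |p - q| := by
  induction h with
  | refl => simp at hx
  | cycle => grind
  | cons => grind
  | trans h => grind [h.subset]

theorem zigzag (h : CycleRemoval l F m) {σ : Bool} (hz : Zigzag σ l) : Zigzag σ m := by
  induction h generalizing σ with
  | refl => exact hz
  | @cycle s₁ s₂ s₃ s₄ l _ _ _ _ _ ih =>
    apply ih
    cases l <;> cases σ <;> simp only [Zigzag] at hz ⊢ <;> grind
  | cons _ ih => exact ⟨hz.1, ih hz.2⟩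
  | trans _ _ ih ih' => exact ih' (ih hz)

theorem stopDown_eq (h : CycleRemoval l F m) {σ : Bool} (hz : Zigzag σ l) {t B : ℝ}
    (hB : B ∈ Set.Icc 0 t) :
    stopDown t B l = (F.map (min · t)).sum + stopDown t B m := by
  induction h generalizing σ B with
  | refl => simp
  | @cycle s₁ s₂ s₃ s₄ l _ _ h₁ h₂ _ ih =>
    have hnest : (s₁ ≤ s₃ ∧ s₃ ≤ s₂ ∧ s₂ ≤ s₄) ∨ (s₄ ≤ s₂ ∧ s₂ ≤ s₃ ∧ s₃ ≤ s₁) := by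
      cases σ <;> simp only [Zigzag] at hz <;> grind
    have hz' := (CycleRemoval.cycle h₁ h₂ (.refl (s₁ :: s₄ :: l))).zigzag hz
    rw [stopDown_wipe_out hB hnest, ih hz' hB, List.map_cons, List.sum_cons, add_assoc]
  | cons _ ih =>
    rw [stopDown, stopDown, ih hz.2 (clampTo_add_mem hB _)]
    ring
  | trans h _ ih ih' =>
    rw [ih hz hB, ih' (h.zigzag hz) hB, List.map_append, List.sum_append, add_assoc]

end CycleRemoval

/-! ### The residue -/

/-- No four consecutive points of the profile enclose a cycle. -/
def NoCycle : List ℝ → Prop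
  | s₁ :: s₂ :: s₃ :: s₄ :: l =>
      ¬ (|s₂ - s₃| ≤ |s₁ - s₂| ∧ |s₂ - s₃| ≤ |s₃ - s₄|) ∧ NoCycle (s₂ :: s₃ :: s₄ :: l)
  | _ => True

/-- The steps of the profile strictly decrease in size. -/
def StepsDecrease : List ℝ → Prop
  | a :: b :: c :: l => |b - c| < |a - b| ∧ StepsDecrease (b :: c :: l)
  | _ => True

theorem NoCycle.tail {a : ℝ} {l : List ℝ} (h : NoCycle (a :: l)) : NoCycle l := by
  match l, h with
  | [], _ => trivial
  | [_], _ => trivial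
  | [_, _], _ => trivial
  | _ :: _ :: _ :: _, h => exact h.2

theorem StepsDecrease.tail {a : ℝ} {l : List ℝ} (h : StepsDecrease (a :: l)) :
    StepsDecrease l := by
  match l, h with
  | [], _ => trivial
  | [_], _ => trivial
  | _ :: _ :: _, h => exact h.2

theorem NoCycle.stepsDecrease {a b c : ℝ} {l : List ℝ} (h : NoCycle (a :: b :: c :: l))
    (hab : |b - c| ≤ |a - b|) : StepsDecrease (b :: c :: l) := by
  induction l generalizing a b c with
  | nil => trivial
  | cons d l ih =>
    have hcd : |c - d| < |b - c| := not_le.1 fun h' => h.1 ⟨hab, h'⟩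
    exact ⟨hcd, ih h.2 hcd.le⟩

theorem rainflowSweep_shortens_or_noCycle (l : List ℝ) :
    (rainflowSweep l).2.length < l.length ∨ (rainflowSweep l).2 = l ∧ NoCycle l := by
  induction l using rainflowSweep.induct with
  | case1 s₁ s₂ s₃ s₄ l h ih =>
    rw [rainflowSweep, if_pos h]
    grind
  | case2 s₁ s₂ s₃ s₄ l h ih =>
    rw [rainflowSweep, if_neg h]
    simp only [NoCycle]
    grind
  | case3 l h =>
    refine .inr ⟨by rw [rainflowSweep.eq_2 _ h], ?_⟩
    unfold NoCycle
    grind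

theorem noCycle_rainflowSweeps {k : ℕ} {l : List ℝ} (h : l.length ≤ k) :
    NoCycle (rainflowSweeps k l).2 := by
  induction k generalizing l with
  | zero => rw [List.length_eq_zero_iff.1 (Nat.le_zero.1 h)]; trivial
  | succ k ih =>
    rcases rainflowSweep_shortens_or_noCycle l with hlt | ⟨he, hn⟩
    · exact ih (by omega)
    · have hfix : ∀ j, (rainflowSweeps j l).2 = l := by
        intro j
        induction j with
        | zero => rfl
        | succ j ihj => simp only [rainflowSweeps, he, ihj]
      rwa [hfix]

/-- What remains of a profile when rainflow counting has removed all full cycles. -/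
def residue (l : List ℝ) : List ℝ :=
  (rainflowSweeps (localExtrema l).length (localExtrema l)).2

theorem noCycle_residue (l : List ℝ) : NoCycle (residue l) := noCycle_rainflowSweeps le_rfl

theorem cycleRemoval_residue (l : List ℝ) :
    CycleRemoval (localExtrema l) (rainflow l).full (residue l) :=
  cycleRemoval_rainflowSweeps _ _

theorem residue_subset (l : List ℝ) : residue l ⊆ l :=
  fun _ hx => localExtrema_subset l ((cycleRemoval_residue l).subset hx)

theorem exists_zigzag_residue (l : List ℝ) : ∃ σ, Zigzag σ (residue l) :=
  (exists_zigzag_localExtrema l).imp fun _ h => (cycleRemoval_residue l).zigzag h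

/-! ### Reflection -/

theorem localExtrema_neg (l : List ℝ) :
    localExtrema (l.map (- ·)) = (localExtrema l).map (- ·) := by
  induction l using localExtrema.induct with
  | case5 a b c l h ih =>
    rw [localExtrema, if_pos h, ← ih]
    simp only [List.map_cons]
    rw [localExtrema, if_pos (by simpa only [neg_le_neg_iff, and_comm, or_comm] using h)]
  | case6 a b c l h ih =>
    rw [localExtrema, if_neg h]
    simp only [List.map_cons] at ih ⊢
    rw [← ih, localExtrema, if_neg (by simpa only [neg_le_neg_iff, and_comm, or_comm] using h)]
  | _ => simp_all [localExtrema]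

theorem rainflowSweep_neg (l : List ℝ) :
    rainflowSweep (l.map (- ·)) = ((rainflowSweep l).1, (rainflowSweep l).2.map (- ·)) := by
  have hdist (a b : ℝ) : |-a - -b| = |a - b| := by rw [neg_sub_neg, abs_sub_comm]
  induction l using rainflowSweep.induct with
  | case1 s₁ s₂ s₃ s₄ l h ih =>
    rw [rainflowSweep, if_pos h]
    simp only [List.map_cons] at ih ⊢
    rw [rainflowSweep, if_pos (by simpa only [hdist] using h), ih, hdist]
  | case2 s₁ s₂ s₃ s₄ l h ih =>
    rw [rainflowSweep, if_neg h]
    simp only [List.map_cons] at ih ⊢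
    rw [rainflowSweep, if_neg (by simpa only [hdist] using h), ih]
  | case3 l h =>
    have hmap : ∀ s₁ s₂ s₃ s₄ m, l.map (- ·) = s₁ :: s₂ :: s₃ :: s₄ :: m → False := by
      simp only [List.map_eq_cons_iff]
      rintro - - - - - ⟨s₁, -, rfl, -, s₂, -, rfl, -, s₃, -, rfl, -, s₄, m, rfl, -⟩
      exact h s₁ s₂ s₃ s₄ m rfl
    rw [rainflowSweep.eq_2 _ h, rainflowSweep.eq_2 _ hmap]

theorem rainflowSweeps_neg (k : ℕ) (l : List ℝ) :
    rainflowSweeps k (l.map (- ·)) =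
      ((rainflowSweeps k l).1, (rainflowSweeps k l).2.map (- ·)) := by
  induction k generalizing l with
  | zero => rfl
  | succ k ih => simp only [rainflowSweeps, rainflowSweep_neg, ih]

theorem chargeHalfCycles_neg (l : List ℝ) :
    chargeHalfCycles (l.map (- ·)) = dischargeHalfCycles l := by
  induction l with
  | nil => rfl
  | cons a l ih =>
    cases l with
    | nil => rfl
    | cons b l =>
      simp only [List.map_cons, chargeHalfCycles, dischargeHalfCycles, neg_lt_neg_iff,
        neg_sub_neg] at ih ⊢
      rw [ih]

theorem dischargeHalfCycles_neg (l : List ℝ) :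
    dischargeHalfCycles (l.map (- ·)) = chargeHalfCycles l := by
  rw [← chargeHalfCycles_neg, List.map_map]
  simp

theorem rainflow_neg (l : List ℝ) :
    rainflow (l.map (- ·)) =
      ⟨(rainflow l).full, (rainflow l).discharge, (rainflow l).charge⟩ := by
  simp only [rainflow, localExtrema_neg, List.length_map, rainflowSweeps_neg,
    chargeHalfCycles_neg, dischargeHalfCycles_neg]

/-! ### Strokes -/

/-- Depths of all upward strokes: every full cycle and every charge half cycle. -/
def Cycles.ups (y : Cycles) : List ℝ := y.full ++ y.charge

/-- Depths of all downward strokes: every full cycle and every discharge half cycle. -/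
def Cycles.downs (y : Cycles) : List ℝ := y.full ++ y.discharge

theorem ups_rainflow_neg (l : List ℝ) : (rainflow (l.map (- ·))).ups = (rainflow l).downs := by
  rw [rainflow_neg]; rfl

theorem downs_rainflow_neg (l : List ℝ) : (rainflow (l.map (- ·))).downs = (rainflow l).ups := by
  rw [rainflow_neg]; rfl

/-- The total price of the strokes of a profile, `f` for upward and `g` for downward ones. -/
def strokeCost (f g : ℝ → ℝ) (l : List ℝ) : ℝ :=
  ((rainflow l).ups.map f).sum + ((rainflow l).downs.map g).sum

theorem strokeCost_neg (f g : ℝ → ℝ) (l : List ℝ) :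
    strokeCost f g (l.map (- ·)) = strokeCost g f l := by
  rw [strokeCost, ups_rainflow_neg, downs_rainflow_neg, add_comm, strokeCost]

theorem lifeLoss_eq_sum_ups_add_sum_downs (Φ : ℝ → ℝ) (y : Cycles) :
    lifeLoss Φ y = (y.ups.map fun x => Φ x / 2).sum + (y.downs.map fun x => Φ x / 2).sum := by
  have hfull : (y.full.map Φ).sum = (y.full.map fun x => Φ x / 2).sum * 2 := by
    rw [← List.sum_map_mul_right]
    simp
  simp only [lifeLoss, Cycles.ups, Cycles.downs, List.map_append, List.sum_append, hfull]
  ring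

theorem exists_sub_eq_of_mem_chargeHalfCycles {l : List ℝ} {x : ℝ} (hx : x ∈ chargeHalfCycles l) :
    ∃ p ∈ l, ∃ q ∈ l, p < q ∧ x = q - p := by
  fun_induction chargeHalfCycles l <;> grind

/-- A bound on the distance between any two points of the profile. -/
def SpreadLE (w : ℝ) (l : List ℝ) : Prop := ∀ p ∈ l, ∀ q ∈ l, |p - q| ≤ w

theorem SpreadLE.subset {w : ℝ} {l m : List ℝ} (h : SpreadLE w l) (hm : m ⊆ l) : SpreadLE w m :=
  fun p hp q hq => h p (hm hp) q (hm hq)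

theorem SpreadLE.tail {w a : ℝ} {l : List ℝ} (h : SpreadLE w (a :: l)) : SpreadLE w l :=
  h.subset (List.subset_cons_self a l)

theorem SpreadLE.abs_mem_Icc {w a b : ℝ} {l : List ℝ} (h : SpreadLE w (a :: b :: l)) :
    |a - b| ∈ Set.Icc 0 w :=
  ⟨abs_nonneg _, h a (by simp) b (by simp)⟩

theorem SpreadLE.neg {w : ℝ} {l : List ℝ} (h : SpreadLE w l) : SpreadLE w (l.map (- ·)) := by
  simp only [SpreadLE, List.forall_mem_map, neg_sub_neg]
  exact fun p hp q hq => h q hq p hp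

theorem SpreadLE.ups_mem_Icc {w : ℝ} {l : List ℝ} (h : SpreadLE w l) :
    ∀ x ∈ (rainflow l).ups, x ∈ Set.Icc 0 w := by
  intro x hx
  rcases List.mem_append.1 hx with hfull | hcharge
  · obtain ⟨p, hp, q, hq, rfl⟩ := (cycleRemoval_residue l).exists_depth_eq hfull
    exact ⟨abs_nonneg _, h.subset (localExtrema_subset l) p hp q hq⟩
  · obtain ⟨p, hp, q, hq, hpq, rfl⟩ := exists_sub_eq_of_mem_chargeHalfCycles hcharge
    exact ⟨sub_nonneg.2 hpq.le,
      (le_abs_self _).trans (h.subset (residue_subset l) q hq p hp)⟩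

theorem SpreadLE.downs_mem_Icc {w : ℝ} {l : List ℝ} (h : SpreadLE w l) :
    ∀ x ∈ (rainflow l).downs, x ∈ Set.Icc 0 w :=
  ups_rainflow_neg l ▸ h.neg.ups_mem_Icc

/-! ### Truncated downward strokes and the stop operator -/

section Stop

variable {t B a b c : ℝ}

theorem stopDown_pair (hB : B ∈ Set.Icc 0 t) (hab : b ≤ a) (hroom : min (a - b) t ≤ B) :
    stopDown t B [a, b] = min (a - b) t := by
  simp only [stopDown, clampTo, Set.mem_Icc] at *
  grind

theorem stopDown_down_up (hB : B ∈ Set.Icc 0 t) (hab : b ≤ a) (hbc : b ≤ c)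
    (hroom : min (a - b) t ≤ B) (l : List ℝ) :
    stopDown t B (a :: b :: c :: l) = min (a - b) t +
      stopDown t (clampTo t (clampTo t (B + (b - a)) + (c - b))) (c :: l) := by
  rw [stopDown, stopDown, ← add_assoc]
  congr 1
  simp only [clampTo, Set.mem_Icc] at *
  grind

theorem stopDown_up_of_full (ht : 0 ≤ t) (hab : a ≤ b) (l : List ℝ) :
    stopDown t t (a :: b :: l) = stopDown t t (b :: l) := by
  have hfull : clampTo t (t + (b - a)) = t := by simp only [clampTo]; grind
  rw [stopDown, hfull, sub_self, max_self, zero_add]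

theorem min_le_clampTo_add (hB : B ∈ Set.Icc 0 t) {x y : ℝ} (h : x ≤ y) :
    min x t ≤ clampTo t (B + y) := by
  simp only [clampTo, Set.mem_Icc] at *
  grind

theorem clampTo_refill (ht : 0 ≤ t) (hbc : b ≤ c) (hac : a ≤ c) :
    clampTo t (clampTo t (t + (b - a)) + (c - b)) = t := by
  simp only [clampTo]
  grind

end Stop

/-- While the room `B` covers the truncated depth of the next downward step, the stop operator
registers every downward step up to truncation. The room stays large enough because the steps
shrink, or else the profile is still growing and every upward step refills the window. -/
theorem stopDown_eq_sum_min_discharge_of_down {t : ℝ} : ∀ (l : List ℝ) {a b B : ℝ},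
    B ∈ Set.Icc 0 t → Zigzag false (a :: b :: l) → min (a - b) t ≤ B →
    StepsDecrease (a :: b :: l) ∨ B = t ∧ NoCycle (a :: b :: l) →
    stopDown t B (a :: b :: l) = ((dischargeHalfCycles (a :: b :: l)).map (min · t)).sum
  | [], a, b, B, hB, hz, hroom, _ => by
    have hab : b < a := hz.1
    simp [stopDown_pair hB hab.le hroom, dischargeHalfCycles, hab]
  | [c], a, b, B, hB, hz, hroom, _ => by
    have hab : b < a := hz.1
    have hbc : b < c := hz.2.1
    rw [stopDown_down_up hB hab.le hbc.le hroom]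
    simp [stopDown, dischargeHalfCycles, hab, hbc.not_gt]
  | c :: d :: l, a, b, B, hB, hz, hroom, hshape => by
    have hab : b < a := hz.1
    have hbc : b < c := hz.2.1
    have hcd : d < c := hz.2.2.1
    have hshrink : StepsDecrease (b :: c :: d :: l) → c - d ≤ c - b := fun h => by
      have := h.1
      rw [abs_of_pos (sub_pos.2 hcd), abs_of_neg (sub_neg.2 hbc)] at this
      linarith
    have hB' := clampTo_add_mem hB (b - a)
    rw [stopDown_down_up hB hab.le hbc.le hroom, dischargeHalfCycles, if_pos hab,
      dischargeHalfCycles, if_neg hbc.not_gt, List.map_cons, List.sum_cons]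
    congr 1
    rcases hshape with hdec | ⟨rfl, hn⟩
    · exact stopDown_eq_sum_min_discharge_of_down l (clampTo_add_mem hB' _) hz.2.2
        (min_le_clampTo_add hB' (hshrink hdec.tail)) (.inl hdec.tail.tail)
    rcases le_total |b - c| |a - b| with hle | hle
    · have hdec := hn.stepsDecrease hle
      exact stopDown_eq_sum_min_discharge_of_down l (clampTo_add_mem hB' _) hz.2.2
        (min_le_clampTo_add hB' (hshrink hdec)) (.inl hdec.tail)
    · rw [abs_of_pos (sub_pos.2 hab), abs_of_neg (sub_neg.2 hbc)] at hle
      rw [clampTo_refill (hB.1.trans hB.2) hbc.le (by linarith)]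
      exact stopDown_eq_sum_min_discharge_of_down l ⟨hB.1, le_rfl⟩ hz.2.2 (min_le_right _ _)
        (.inr ⟨rfl, hn.tail.tail⟩)

theorem stopDown_eq_sum_min_discharge {t : ℝ} (ht : 0 ≤ t) {σ : Bool} {l : List ℝ}
    (hz : Zigzag σ l) (hn : NoCycle l) :
    stopDown t t l = ((dischargeHalfCycles l).map (min · t)).sum := by
  have hdown : ∀ m, Zigzag false m → NoCycle m →
      stopDown t t m = ((dischargeHalfCycles m).map (min · t)).sum := by
    rintro (_ | ⟨a, _ | ⟨b, m⟩⟩) hz hn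
    · rfl
    · rfl
    · exact stopDown_eq_sum_min_discharge_of_down m ⟨ht, le_rfl⟩ hz (min_le_right _ _)
        (.inr ⟨rfl, hn⟩)
  match σ, l, hz, hn with
  | false, l, hz, hn => exact hdown l hz hn
  | true, [], _, _ => rfl
  | true, [_], _, _ => rfl
  | true, a :: b :: l, hz, hn =>
    have hab : a < b := hz.1
    rw [stopDown_up_of_full ht hab.le, dischargeHalfCycles, if_neg hab.not_gt]
    exact hdown _ hz.2 hn.tail

theorem sum_min_downs {t : ℝ} (ht : 0 ≤ t) (l : List ℝ) :
    ((rainflow l).downs.map (min · t)).sum = stopDown t t l := by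
  have hmem : t ∈ Set.Icc 0 t := ⟨ht, le_rfl⟩
  obtain ⟨σ, hσ⟩ := exists_zigzag_localExtrema l
  have hremoval := cycleRemoval_residue l
  rw [← stopDown_localExtrema hmem, hremoval.stopDown_eq hσ hmem,
    stopDown_eq_sum_min_discharge ht (hremoval.zigzag hσ) (noCycle_residue l),
    Cycles.downs, List.map_append, List.sum_append]
  rfl

/-! ### Balance of upward and downward strokes -/

/-- The alternating sum `c |s₁ - s₂| - c |s₂ - s₃| + ⋯` of the weights of the steps. -/
def alternatingSum (c : ℝ → ℝ) : List ℝ → ℝ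
  | a :: b :: l => c |a - b| - alternatingSum c (b :: l)
  | _ => 0

theorem sum_charge_sub_sum_discharge (c : ℝ → ℝ) {σ : Bool} {l : List ℝ} (hz : Zigzag σ l) :
    ((chargeHalfCycles l).map c).sum - ((dischargeHalfCycles l).map c).sum =
      if σ then alternatingSum c l else -alternatingSum c l := by
  induction l generalizing σ with
  | nil => simp [chargeHalfCycles, dischargeHalfCycles, alternatingSum]
  | cons a l ih =>
    cases l with
    | nil => simp [chargeHalfCycles, dischargeHalfCycles, alternatingSum]
    | cons b l =>
      have hrest := ih hz.2
      have hstep := hz.1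
      rw [chargeHalfCycles, dischargeHalfCycles, alternatingSum]
      cases σ
      · simp only [Bool.not_false, if_true, Bool.false_eq_true, if_false] at hrest hstep ⊢
        rw [if_neg hstep.not_gt, if_pos hstep, List.map_cons, List.sum_cons,
          abs_of_pos (sub_pos.2 hstep)]
        linarith
      · simp only [Bool.not_true, if_true, Bool.false_eq_true, if_false] at hrest hstep ⊢
        rw [if_pos hstep, if_neg hstep.not_gt, List.map_cons, List.sum_cons,
          abs_of_neg (sub_neg.2 hstep), neg_sub]
        linarith

section Balance

variable {c : ℝ → ℝ} {w : ℝ}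

theorem alternatingSum_mem_of_stepsDecrease (hc : MonotoneOn c (Set.Icc 0 w))
    (hc0 : ∀ x ∈ Set.Icc 0 w, 0 ≤ c x) {a b : ℝ} {l : List ℝ} (hw : SpreadLE w (a :: b :: l))
    (hd : StepsDecrease (a :: b :: l)) :
    alternatingSum c (a :: b :: l) ∈ Set.Icc 0 (c |a - b|) := by
  rw [alternatingSum]
  induction l generalizing a b with
  | nil => simpa [alternatingSum] using hc0 _ hw.abs_mem_Icc
  | cons d l ih =>
    obtain ⟨hlo, hhi⟩ := ih hw.tail hd.2
    have hle : c |b - d| ≤ c |a - b| := hc hw.tail.abs_mem_Icc hw.abs_mem_Icc hd.1.le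
    rw [alternatingSum]
    constructor <;> linarith

theorem alternatingSum_mem_of_noCycle (hc : MonotoneOn c (Set.Icc 0 w))
    (hc0 : ∀ x ∈ Set.Icc 0 w, 0 ≤ c x) {a b : ℝ} {l : List ℝ} (hw : SpreadLE w (a :: b :: l))
    (hn : NoCycle (a :: b :: l)) :
    alternatingSum c (a :: b :: l) ∈ Set.Icc (c |a - b| - c w) (c w) := by
  have hab := hw.abs_mem_Icc
  have hw_mem : w ∈ Set.Icc 0 w := ⟨hab.1.trans hab.2, le_rfl⟩
  have hcw : c |a - b| ≤ c w := hc hab hw_mem hab.2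
  rw [alternatingSum]
  induction l generalizing a b with
  | nil => simpa [alternatingSum] using ⟨hc0 w hw_mem, hcw⟩
  | cons d l ih =>
    have hbd := hw.tail.abs_mem_Icc
    rcases le_or_gt |b - d| |a - b| with hle | hlt
    · obtain ⟨hlo, hhi⟩ :=
        alternatingSum_mem_of_stepsDecrease hc hc0 hw.tail (hn.stepsDecrease hle)
      have := hc hbd hab hle
      constructor <;> linarith
    · obtain ⟨hlo, hhi⟩ := ih hw.tail hn.tail hbd (hc hbd hw_mem hbd.2)
      have := hc hab hbd hlt.le
      rw [alternatingSum]
      constructor <;> linarith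

theorem abs_alternatingSum_le (hw0 : 0 ≤ w) (hc : MonotoneOn c (Set.Icc 0 w))
    (hc0 : ∀ x ∈ Set.Icc 0 w, 0 ≤ c x) {l : List ℝ} (hw : SpreadLE w l) (hn : NoCycle l) :
    |alternatingSum c l| ≤ c w := by
  have hcw := hc0 w ⟨hw0, le_rfl⟩
  match l, hw, hn with
  | [], _, _ => simpa [alternatingSum] using hcw
  | [_], _, _ => simpa [alternatingSum] using hcw
  | a :: b :: l, hw, hn =>
    obtain ⟨hlo, hhi⟩ := alternatingSum_mem_of_noCycle hc hc0 hw hn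
    have := hc0 _ hw.abs_mem_Icc
    exact abs_le.2 ⟨by linarith, hhi⟩

end Balance

/-- Two lists of stroke depths in `[0, w]` that balance, for every monotone nonnegative weight, up
to the weight of the largest possible depth. -/
structure Balanced (w : ℝ) (as bs : List ℝ) : Prop where
  mem_left : ∀ x ∈ as, x ∈ Set.Icc 0 w
  mem_right : ∀ x ∈ bs, x ∈ Set.Icc 0 w
  abs_sub_le : ∀ c : ℝ → ℝ, MonotoneOn c (Set.Icc 0 w) → (∀ x ∈ Set.Icc 0 w, 0 ≤ c x) →
    |(as.map c).sum - (bs.map c).sum| ≤ c w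

/-- Full cycles cancel and the residue alternates. -/
theorem SpreadLE.balanced {w : ℝ} (hw0 : 0 ≤ w) {l : List ℝ} (hw : SpreadLE w l) :
    Balanced w (rainflow l).ups (rainflow l).downs where
  mem_left := hw.ups_mem_Icc
  mem_right := hw.downs_mem_Icc
  abs_sub_le c hc hc0 := by
    obtain ⟨σ, hσ⟩ := exists_zigzag_residue l
    have hsum := sum_charge_sub_sum_discharge c hσ
    have hle := abs_alternatingSum_le hw0 hc hc0 (hw.subset (residue_subset l)) (noCycle_residue l)
    simp only [Cycles.ups, Cycles.downs, List.map_append, List.sum_append,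
      add_sub_add_left_eq_sub]
    change |((chargeHalfCycles (residue l)).map c).sum -
      ((dischargeHalfCycles (residue l)).map c).sum| ≤ c w
    rw [hsum]
    split_ifs
    · exact hle
    · rwa [abs_neg]

/-! ### Convex functions and their minimizers -/

section ConvexMin

variable {s : Set ℝ} {f : ℝ → ℝ} {m : ℝ}

theorem monotoneOn_of_convexOn_of_isMinOn (hf : ConvexOn ℝ s f) (hm : m ∈ s)
    (hmin : IsMinOn f s m) : MonotoneOn f (s ∩ Set.Ici m) := by
  rintro x ⟨hx, hmx⟩ y ⟨hy, -⟩ hxy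
  rcases (Set.mem_Ici.1 hmx).eq_or_lt with rfl | hmx
  · exact hmin hy
  rcases hxy.eq_or_lt with rfl | hxy
  · rfl
  exact hf.le_right_of_left_le hm hy (openSegment_eq_Ioo (hmx.trans hxy) ▸ ⟨hmx, hxy⟩) (hmin hx)

theorem antitoneOn_of_convexOn_of_isMinOn (hf : ConvexOn ℝ s f) (hm : m ∈ s)
    (hmin : IsMinOn f s m) : AntitoneOn f (s ∩ Set.Iic m) := by
  rintro x ⟨hx, -⟩ y ⟨hy, hym⟩ hxy
  rcases (Set.mem_Iic.1 hym).eq_or_lt with rfl | hym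
  · exact hmin hx
  rcases hxy.eq_or_lt with rfl | hxy
  · rfl
  exact hf.le_left_of_right_le hx hm (openSegment_eq_Ioo (hxy.trans hym) ▸ ⟨hxy, hym⟩) (hmin hy)

theorem convexOn_comp_max_of_isMinOn (hf : ConvexOn ℝ s f) (hm : m ∈ s) (hmin : IsMinOn f s m) :
    ConvexOn ℝ s fun x => f (max x m) := by
  have mem_max : ∀ {x : ℝ}, x ∈ s → max x m ∈ s := fun {x} hx => by
    rcases max_choice x m with h | h <;> rwa [h]
  refine ⟨hf.1, fun x hx y hy a b ha hb hab => ?_⟩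
  have hle : max (a • x + b • y) m ≤ a • max x m + b • max y m :=
    ((convexOn_id hf.1).sup (convexOn_const m hf.1)).2 hx hy ha hb hab
  exact (monotoneOn_of_convexOn_of_isMinOn hf hm hmin
    ⟨mem_max (hf.1 hx hy ha hb hab), Set.mem_Ici.2 (le_max_right _ _)⟩
    ⟨hf.1 (mem_max hx) (mem_max hy) ha hb hab, Set.mem_Ici.2 ((le_max_right _ _).trans hle)⟩
    hle).trans (hf.2 (mem_max hx) (mem_max hy) ha hb hab)

theorem isMinOn_left_of_convexOn_of_eq {q : ℝ} (hf : ConvexOn ℝ s f) (hq : q ∈ s) (hmq : m < q)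
    (h : f m = f q) : IsMinOn f (s ∩ Set.Iic m) m := by
  rintro x ⟨hx, hxm⟩
  rcases (Set.mem_Iic.1 hxm).eq_or_lt with rfl | hxm
  · exact le_refl (f x)
  by_contra! hlt
  exact (hf.lt_right_of_left_lt hx hq (openSegment_eq_Ioo (hxm.trans hmq) ▸ ⟨hxm, hmq⟩)
    (not_le.1 hlt)).ne h

end ConvexMin

/-! ### Weak majorization -/

/-- Tilting `f` until it takes equal values at `p` and `τ` moves its minimum down to `p`. -/
theorem exists_tilt {p τ K : ℝ} {f : ℝ → ℝ} (hp : p ∈ Set.Ico 0 τ)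
    (hf : ConvexOn ℝ (Set.Icc 0 τ) f) (f_zero : f 0 = 0) (hmin : IsMinOn f (Set.Icc 0 τ) τ)
    (hfK : -(K * τ) ≤ f τ) :
    ∃ c, 0 ≤ c ∧ c ≤ K ∧ f p + c * p = f τ + c * τ ∧
      ConvexOn ℝ (Set.Icc 0 p) (fun x => f x + c * x) ∧
      IsMinOn (fun x => f x + c * x) (Set.Icc 0 p) p := by
  obtain ⟨hp0, hpτ⟩ := hp
  have hτ_mem : τ ∈ Set.Icc 0 τ := ⟨hp0.trans hpτ.le, le_rfl⟩
  have hpτ' : 0 < τ - p := sub_pos.2 hpτ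
  have hc0 : 0 ≤ (f p - f τ) / (τ - p) :=
    div_nonneg (sub_nonneg.2 (hmin ⟨hp0, hpτ.le⟩)) hpτ'.le
  have hcp : (f p - f τ) / (τ - p) * (τ - p) = f p - f τ := div_mul_cancel₀ _ hpτ'.ne'
  set c := (f p - f τ) / (τ - p)
  have h_eq : f p + c * p = f τ + c * τ := by linarith
  have h_conv : ConvexOn ℝ (Set.Icc 0 τ) (fun x => f x + c * x) :=
    hf.add ((convexOn_id (convex_Icc 0 τ)).smul hc0)
  have h_min : IsMinOn (fun x => f x + c * x) (Set.Icc 0 p) p :=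
    (isMinOn_left_of_convexOn_of_eq h_conv hτ_mem hpτ h_eq).on_subset
      fun x hx => ⟨⟨hx.1, hx.2.trans hpτ.le⟩, hx.2⟩
  refine ⟨c, hc0, ?_, h_eq, h_conv.subset (Set.Icc_subset_Icc_right hpτ.le) (convex_Icc _ _),
    h_min⟩
  have h_le : f p + c * p ≤ f 0 + c * 0 := h_min ⟨le_rfl, hp0⟩
  exact le_of_mul_le_mul_right (by linarith) (hp0.trans_lt hpτ)

/-- Decreasing convex functions are mixtures of truncations. -/
theorem exists_mixture_of_convexOn (S : Finset ℝ) {τ K : ℝ} {f : ℝ → ℝ} (hτ : 0 ≤ τ)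
    (hK : 0 ≤ K) (hf : ConvexOn ℝ (Set.Icc 0 τ) f) (f_zero : f 0 = 0)
    (hmin : IsMinOn f (Set.Icc 0 τ) τ) (hfK : ∀ t ∈ Set.Icc 0 τ, -(K * t) ≤ f t)
    (hS : ∀ x ∈ S, x ∈ Set.Ico 0 τ) :
    ∃ m : List (ℝ × ℝ), (∀ q ∈ m, 0 ≤ q.1 ∧ q.2 ∈ Set.Icc 0 τ) ∧ (m.map Prod.fst).sum ≤ K ∧
      ∀ x, x ∈ S ∨ x = τ → f x = -(m.map fun q => q.1 * min x q.2).sum := by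
  have hτ_mem : τ ∈ Set.Icc 0 τ := ⟨hτ, le_rfl⟩
  induction S using Finset.induction_on_max generalizing τ K f with
  | empty =>
    have hfτ : f τ ≤ 0 := f_zero ▸ hmin ⟨le_rfl, hτ⟩
    refine ⟨[(-f τ / τ, τ)], ?_, ?_, ?_⟩
    · simpa [hτ] using div_nonneg (neg_nonneg.2 hfτ) hτ
    · simpa using div_le_of_le_mul₀ hτ hK (neg_le.1 (hfK τ hτ_mem))
    · rintro x (hx | rfl)
      · simp at hx
      · rcases eq_or_ne x 0 with rfl | hx
        · simp [f_zero]
        · simp [hx]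
  | insert p S hp ih =>
    obtain ⟨hp0, hpτ⟩ := hS p (Finset.mem_insert_self _ _)
    obtain ⟨c, hc0, hcK, tilt_eq, tilt_conv, tilt_min⟩ :=
      exists_tilt ⟨hp0, hpτ⟩ hf f_zero hmin (hfK τ hτ_mem)
    obtain ⟨m, hm, hm_sum, hm_eq⟩ := ih hp0 (sub_nonneg.2 hcK) tilt_conv (by simp [f_zero])
      tilt_min (fun t ht => by linarith [hfK t ⟨ht.1, ht.2.trans hpτ.le⟩])
      (fun x hx => ⟨(hS x (Finset.mem_insert_of_mem hx)).1, hp x hx⟩) ⟨hp0, le_rfl⟩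
    have hm_top : (m.map fun q => q.1 * min τ q.2) = m.map fun q => q.1 * min p q.2 :=
      List.map_congr_left fun q hq => by
        rw [min_eq_right (hm q hq).2.2, min_eq_right ((hm q hq).2.2.trans hpτ.le)]
    refine ⟨(c, τ) :: m, ?_, ?_, ?_⟩
    · rintro q (_ | ⟨_, hq⟩)
      · exact ⟨hc0, hτ_mem⟩
      · exact ⟨(hm q hq).1, (hm q hq).2.1, (hm q hq).2.2.trans hpτ.le⟩
    · rw [List.map_cons, List.sum_cons]
      linarith
    · rintro x (hx | rfl) <;> rw [List.map_cons, List.sum_cons]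
      · rw [min_eq_left (hS x hx).2.le]
        linarith [hm_eq x (Finset.mem_insert.1 hx).symm]
      · rw [hm_top, min_self]
        linarith [hm_eq p (Or.inr rfl)]

/-- Weak majorization with slack: the sums of the depths in `hs`, truncated at any level up to `u`,
exceed those of `ks` by at most `O`. -/
def TruncatedSumsLE (u O : ℝ) (hs ks : List ℝ) : Prop :=
  ∀ t ∈ Set.Icc 0 u, (hs.map (min · t)).sum ≤ (ks.map (min · t)).sum + O

theorem TruncatedSumsLE.mono {u u' O : ℝ} {hs ks : List ℝ} (h : TruncatedSumsLE u O hs ks)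
    (hu : u' ≤ u) : TruncatedSumsLE u' O hs ks :=
  fun t ht => h t ⟨ht.1, ht.2.trans hu⟩

theorem sum_sum_mul_min (m : List (ℝ × ℝ)) (l : List ℝ) :
    (l.map fun x => (m.map fun q => q.1 * min x q.2).sum).sum =
      (m.map fun q => q.1 * (l.map (min · q.2)).sum).sum := by
  induction m with
  | nil => simp
  | cons q m ih => simp only [List.map_cons, List.sum_cons, List.sum_map_add, ih,
      List.sum_map_mul_left]

theorem TruncatedSumsLE.sum_mixture_le {u O : ℝ} {hs ks : List ℝ} {m : List (ℝ × ℝ)}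
    (h : TruncatedSumsLE u O hs ks) (hm : ∀ q ∈ m, 0 ≤ q.1 ∧ q.2 ∈ Set.Icc 0 u) :
    (m.map fun q => q.1 * (hs.map (min · q.2)).sum).sum ≤
      (m.map fun q => q.1 * (ks.map (min · q.2)).sum).sum + (m.map Prod.fst).sum * O := by
  rw [← List.sum_map_mul_right, ← List.sum_map_add]
  refine List.sum_le_sum fun q hq => ?_
  rw [← mul_add]
  exact mul_le_mul_of_nonneg_left (h q.2 (hm q hq).2) (hm q hq).1

theorem TruncatedSumsLE.sum_convex_le {hs ks : List ℝ} {O τ K : ℝ} {f : ℝ → ℝ}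
    (h : TruncatedSumsLE τ O hs ks) (hO : 0 ≤ O) (hτ : 0 ≤ τ) (hK : 0 ≤ K)
    (hf : ConvexOn ℝ (Set.Icc 0 τ) f) (f_zero : f 0 = 0) (hmin : IsMinOn f (Set.Icc 0 τ) τ)
    (hfK : ∀ t ∈ Set.Icc 0 τ, -(K * t) ≤ f t) (hs0 : ∀ x ∈ hs, 0 ≤ x) (ks0 : ∀ x ∈ ks, 0 ≤ x) :
    (ks.map fun k => f (min k τ)).sum ≤ (hs.map fun h => f (min h τ)).sum + K * O := by
  have mem_nonneg : ∀ x ∈ hs ++ ks, 0 ≤ x := fun x hx =>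
    (List.mem_append.1 hx).elim (hs0 x) (ks0 x)
  obtain ⟨m, hm, hm_sum, hm_eq⟩ := exists_mixture_of_convexOn
    ((hs ++ ks).toFinset.filter (· < τ)) hτ hK hf f_zero hmin hfK fun x hx => by
      rw [Finset.mem_filter, List.mem_toFinset] at hx
      exact ⟨mem_nonneg x hx.1, hx.2⟩
  have price_eq : ∀ x ∈ hs ++ ks, f (min x τ) = -(m.map fun q => q.1 * min x q.2).sum := by
    intro x hx
    have hm_min : (m.map fun q => q.1 * min (min x τ) q.2) = m.map fun q => q.1 * min x q.2 :=
      List.map_congr_left fun q hq => by rw [min_assoc, min_eq_right (hm q hq).2.2]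
    rw [← hm_min]
    refine hm_eq _ ?_
    rcases lt_or_ge x τ with hlt | hge
    · left
      rw [min_eq_left hlt.le, Finset.mem_filter, List.mem_toFinset]
      exact ⟨hx, hlt⟩
    · exact Or.inr (min_eq_right hge)
  have sum_eq : ∀ l : List ℝ, (∀ x ∈ l, x ∈ hs ++ ks) →
      (l.map fun x => f (min x τ)).sum = -(m.map fun q => q.1 * (l.map (min · q.2)).sum).sum := by
    intro l hl
    rw [List.map_congr_left fun x hx => (price_eq x (hl x hx)).trans (neg_one_mul _).symm,
      List.sum_map_mul_left, neg_one_mul, sum_sum_mul_min]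
  rw [sum_eq hs fun x hx => List.mem_append_left ks hx,
    sum_eq ks fun x hx => List.mem_append_right hs hx]
  have := h.sum_mixture_le hm
  have := mul_le_mul_of_nonneg_right hm_sum hO
  linarith

/-! ### Comparison of two families of strokes -/

/-- Convex prices `f` and `g` of the strokes in the two directions, with respective minimizers `v`
and `w`, and the minimizer `u` of their sum in between. -/
structure StrokePrices (f g : ℝ → ℝ) (u v w : ℝ) : Prop where
  convexOn_left : ConvexOn ℝ (Set.Icc 0 1) f
  convexOn_right : ConvexOn ℝ (Set.Icc 0 1) g
  left_zero : f 0 = 0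
  right_zero : g 0 = 0
  nonneg : 0 ≤ v
  le_left : v ≤ u
  le_right : u ≤ w
  le_one : w ≤ 1
  isMinOn_add : IsMinOn (fun x => f x + g x) (Set.Icc 0 1) u
  isMinOn_left : IsMinOn f (Set.Icc 0 1) v
  isMinOn_right : IsMinOn g (Set.Icc 0 1) w

/-- The amount by which the price `f` of a stroke of depth `h` grows, and its price `g` falls, on
the way to `u` and beyond. Moved from one direction to the other, it almost cancels by balance. -/
def transferWeight (f g : ℝ → ℝ) (u v w h : ℝ) : ℝ :=
  f (max (min h u) v) - f v + (g u - g (min (max h u) w))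

/-- The price `g` once the part of `f` beyond its minimizer `v` has been transferred to it; its
minimizer is that of `f + g`. -/
def liftedPrice (f g : ℝ → ℝ) (v h : ℝ) : ℝ := g h + (f (max h v) - f v)

namespace StrokePrices

variable {f g : ℝ → ℝ} {u v w : ℝ}

section

variable (p : StrokePrices f g u v w)
include p

theorem left_mem : v ∈ Set.Icc (0 : ℝ) 1 := ⟨p.nonneg, p.le_left.trans (p.le_right.trans p.le_one)⟩

theorem add_mem : u ∈ Set.Icc (0 : ℝ) 1 := ⟨p.nonneg.trans p.le_left, p.le_right.trans p.le_one⟩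

theorem right_mem : w ∈ Set.Icc (0 : ℝ) 1 := ⟨p.add_mem.1.trans p.le_right, p.le_one⟩

theorem monotoneOn_left : MonotoneOn f (Set.Icc 0 1 ∩ Set.Ici v) :=
  monotoneOn_of_convexOn_of_isMinOn p.convexOn_left p.left_mem p.isMinOn_left

theorem antitoneOn_right : AntitoneOn g (Set.Icc 0 1 ∩ Set.Iic w) :=
  antitoneOn_of_convexOn_of_isMinOn p.convexOn_right p.right_mem p.isMinOn_right

theorem monotoneOn_transferWeight : MonotoneOn (transferWeight f g u v w) (Set.Icc 0 1) := by
  have := p.add_mem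
  have := p.left_mem
  rintro x ⟨x0, x1⟩ y ⟨y0, y1⟩ hxy
  have hf : f (max (min x u) v) ≤ f (max (min y u) v) := by
    apply p.monotoneOn_left
    · simp only [Set.mem_inter_iff, Set.mem_Icc, Set.mem_Ici] at *; grind
    · simp only [Set.mem_inter_iff, Set.mem_Icc, Set.mem_Ici] at *; grind
    · gcongr
  have hg : g (min (max y u) w) ≤ g (min (max x u) w) := by
    have := p.right_mem
    apply p.antitoneOn_right
    · simp only [Set.mem_inter_iff, Set.mem_Icc, Set.mem_Iic] at *; grind
    · simp only [Set.mem_inter_iff, Set.mem_Icc, Set.mem_Iic] at *; grind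
    · gcongr
  simp only [transferWeight]
  linarith

theorem transferWeight_nonneg : ∀ x ∈ Set.Icc (0 : ℝ) 1, 0 ≤ transferWeight f g u v w x := by
  intro x hx
  refine le_trans ?_ (p.monotoneOn_transferWeight ⟨le_rfl, zero_le_one⟩ hx hx.1)
  simp [transferWeight, p.add_mem.1, p.nonneg, p.le_right]

theorem transferWeight_self : transferWeight f g u v w u = f u - f v := by
  simp [transferWeight, p.le_left, p.le_right]

theorem transferWeight_one : transferWeight f g u v w 1 = f u - f v + (g u - g w) := by
  simp [transferWeight, p.le_left, p.add_mem.2, p.le_one]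

theorem convexOn_liftedPrice : ConvexOn ℝ (Set.Icc 0 1) (liftedPrice f g v) :=
  p.convexOn_right.add
    ((convexOn_comp_max_of_isMinOn p.convexOn_left p.left_mem p.isMinOn_left).add_const (-f v))

theorem isMinOn_liftedPrice : IsMinOn (liftedPrice f g v) (Set.Icc 0 1) u := by
  have beyond : ∀ x ∈ Set.Icc v 1, liftedPrice f g v u ≤ liftedPrice f g v x := by
    rintro x ⟨hvx, hx1⟩
    have : f u + g u ≤ f x + g x := p.isMinOn_add ⟨p.nonneg.trans hvx, hx1⟩
    simp only [liftedPrice, max_eq_left p.le_left, max_eq_left hvx]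
    linarith
  rintro x ⟨hx0, hx1⟩
  rcases le_total v x with hvx | hxv
  · exact beyond x ⟨hvx, hx1⟩
  · have : g v ≤ g x := p.antitoneOn_right ⟨⟨hx0, hx1⟩, hxv.trans (p.le_left.trans p.le_right)⟩
      ⟨p.left_mem, p.le_left.trans p.le_right⟩ hxv
    refine (beyond v ⟨le_rfl, p.left_mem.2⟩).trans ?_
    simp only [liftedPrice, max_self, max_eq_right hxv]
    linarith

theorem add_transferWeight_eq_of_le {x : ℝ} (hx : x ≤ u) :
    f (min x v) + transferWeight f g u v w x = f x := by
  simp only [transferWeight, min_eq_left hx, max_eq_right hx, min_eq_left p.le_right]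
  rcases le_total x v with h | h <;> simp [h]

theorem liftedPrice_eq_of_le {x : ℝ} (hx : x ≤ u) :
    liftedPrice f g v (min x u) = g x + transferWeight f g u v w x := by
  simp only [transferWeight, liftedPrice, min_eq_left hx, max_eq_right hx, min_eq_left p.le_right]
  ring

theorem add_transferWeight_le {x : ℝ} (hx : x ∈ Set.Icc (0 : ℝ) 1) :
    f (min x v) + transferWeight f g u v w x ≤ f x := by
  rcases le_total x u with hxu | hux
  · exact (p.add_transferWeight_eq_of_le hxu).le
  rw [transferWeight, min_eq_right (p.le_left.trans hux), min_eq_right hux, max_eq_left p.le_left,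
    max_eq_left hux]
  rcases le_total x w with hxw | hwx
  · have : f u + g u ≤ f x + g x := p.isMinOn_add hx
    rw [min_eq_left hxw]
    linarith
  · have : f u + g u ≤ f w + g w := p.isMinOn_add p.right_mem
    have : f w ≤ f x := p.monotoneOn_left ⟨p.right_mem, p.le_left.trans p.le_right⟩
      ⟨hx, p.le_left.trans hux⟩ hwx
    rw [min_eq_right hwx]
    linarith

theorem liftedPrice_le {x : ℝ} (hx : x ∈ Set.Icc (0 : ℝ) 1) :
    liftedPrice f g v (min x u) ≤ g x + transferWeight f g u v w x := by
  rcases le_total x u with hxu | hux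
  · exact (p.liftedPrice_eq_of_le hxu).le
  have : g (min x w) ≤ g x := by
    rcases le_total x w with hxw | hwx
    · rw [min_eq_left hxw]
    · rw [min_eq_right hwx]
      exact p.isMinOn_right hx
  simp only [transferWeight, liftedPrice, min_eq_right hux, max_eq_left hux]
  linarith

variable {K O : ℝ} {hs ks : List ℝ}

theorem sum_left_le_of_truncatedSumsLE (hK : 0 ≤ K) (hO : 0 ≤ O)
    (hfK : ∀ t ∈ Set.Icc (0 : ℝ) 1, -(K * t) ≤ f t) (h : TruncatedSumsLE u O hs ks)
    (hs_nonneg : ∀ x ∈ hs, 0 ≤ x) (ks_nonneg : ∀ x ∈ ks, 0 ≤ x) :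
    (ks.map fun k => f (min k v)).sum ≤ (hs.map fun h => f (min h v)).sum + K * O := by
  have hv := p.left_mem
  exact (h.mono p.le_left).sum_convex_le hO p.nonneg hK
    (p.convexOn_left.subset (Set.Icc_subset_Icc_right hv.2) (convex_Icc _ _)) p.left_zero
    (p.isMinOn_left.on_subset (Set.Icc_subset_Icc_right hv.2))
    (fun t ht => hfK t ⟨ht.1, ht.2.trans hv.2⟩) hs_nonneg ks_nonneg

theorem sum_liftedPrice_le_of_truncatedSumsLE (hK : 0 ≤ K) (hO : 0 ≤ O)
    (hgK : ∀ t ∈ Set.Icc (0 : ℝ) 1, -(K * t) ≤ g t) (h : TruncatedSumsLE u O hs ks)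
    (hs_nonneg : ∀ x ∈ hs, 0 ≤ x) (ks_nonneg : ∀ x ∈ ks, 0 ≤ x) :
    (ks.map fun k => liftedPrice f g v (min k u)).sum ≤
      (hs.map fun h => liftedPrice f g v (min h u)).sum + K * O := by
  have hu := p.add_mem
  refine h.sum_convex_le hO hu.1 hK
    (p.convexOn_liftedPrice.subset (Set.Icc_subset_Icc_right hu.2) (convex_Icc _ _))
    (by simp [liftedPrice, p.right_zero, p.nonneg])
    (p.isMinOn_liftedPrice.on_subset (Set.Icc_subset_Icc_right hu.2))
    (fun t ht => ?_) hs_nonneg ks_nonneg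
  have := hgK t ⟨ht.1, ht.2.trans hu.2⟩
  have : f v ≤ f (max t v) :=
    p.isMinOn_left ⟨le_max_of_le_left ht.1, max_le (ht.2.trans hu.2) p.left_mem.2⟩
  simp only [liftedPrice]
  linarith

end

/-- The strokes `ky`, `kz` have depth at most the combined minimizer `u`, while `hy`, `hz` are
arbitrary strokes whose truncated sums exceed theirs by at most `O`. -/
theorem sum_le_sum_add_gap {Kf Kg O : ℝ} {hy hz ky kz : List ℝ} (p : StrokePrices f g u v w)
    (hKf : 0 ≤ Kf) (hKg : 0 ≤ Kg) (hO : 0 ≤ O)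
    (hfK : ∀ t ∈ Set.Icc (0 : ℝ) 1, -(Kf * t) ≤ f t)
    (hgK : ∀ t ∈ Set.Icc (0 : ℝ) 1, -(Kg * t) ≤ g t)
    (bal_h : Balanced 1 hy hz) (bal_k : Balanced u ky kz)
    (sum_y : TruncatedSumsLE u O hy ky) (sum_z : TruncatedSumsLE u O hz kz) :
    (ky.map f).sum + (kz.map g).sum ≤
      (hy.map f).sum + (hz.map g).sum + (Kf + Kg) * O + (2 * (f u - f v) + (g u - g w)) := by
  set c := transferWeight f g u v w with hc
  have hu := p.add_mem
  have maj_y := p.sum_left_le_of_truncatedSumsLE hKf hO hfK sum_y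
    (fun x hx => (bal_h.mem_left x hx).1) fun x hx => (bal_k.mem_left x hx).1
  have maj_z := p.sum_liftedPrice_le_of_truncatedSumsLE hKg hO hgK sum_z
    (fun x hx => (bal_h.mem_right x hx).1) fun x hx => (bal_k.mem_right x hx).1
  have split_ky : (ky.map fun k => f (min k v)).sum + (ky.map c).sum = (ky.map f).sum := by
    rw [← List.sum_map_add, List.map_congr_left fun x hx =>
      p.add_transferWeight_eq_of_le (bal_k.mem_left x hx).2]
  have split_kz :
      (kz.map fun k => liftedPrice f g v (min k u)).sum = (kz.map g).sum + (kz.map c).sum := by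
    rw [← List.sum_map_add, List.map_congr_left fun x hx =>
      p.liftedPrice_eq_of_le (bal_k.mem_right x hx).2]
  have split_hy : (hy.map fun h => f (min h v)).sum + (hy.map c).sum ≤ (hy.map f).sum := by
    rw [← List.sum_map_add]
    exact List.sum_le_sum fun x hx => p.add_transferWeight_le (bal_h.mem_left x hx)
  have split_hz :
      (hz.map fun h => liftedPrice f g v (min h u)).sum ≤ (hz.map g).sum + (hz.map c).sum := by
    rw [← List.sum_map_add]
    exact List.sum_le_sum fun x hx => p.liftedPrice_le (bal_h.mem_right x hx)
  have hbal_h := abs_le.1 (bal_h.abs_sub_le c p.monotoneOn_transferWeight p.transferWeight_nonneg)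
  have hbal_k := abs_le.1 (bal_k.abs_sub_le c
    (p.monotoneOn_transferWeight.mono (Set.Icc_subset_Icc_right hu.2))
    fun x hx => p.transferWeight_nonneg x ⟨hx.1, hx.2.trans hu.2⟩)
  rw [hc, p.transferWeight_one] at hbal_h
  rw [hc, p.transferWeight_self] at hbal_k
  linarith

end StrokePrices

/-! ### The stop operator along a sequence -/

/-- The points of a sequence up to index `N`, as a profile. -/
def profileOf (N : ℕ) (z : ℕ → ℝ) : List ℝ := (List.range (N + 1)).map z

/-- The state of the stop operator of width `t`, started at `β`, along a sequence. -/
def stopState (t β : ℝ) (z : ℕ → ℝ) : ℕ → ℝ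
  | 0 => β
  | n + 1 => clampTo t (stopState t β z n + (z (n + 1) - z n))

theorem stopState_shift (t β : ℝ) (z : ℕ → ℝ) (n : ℕ) :
    stopState t β z (n + 1) =
      stopState t (clampTo t (β + (z 1 - z 0))) (fun k => z (k + 1)) n := by
  induction n with
  | zero => rfl
  | succ n ih => rw [stopState, ih]; rfl

theorem profileOf_succ (N : ℕ) (z : ℕ → ℝ) :
    profileOf (N + 1) z = z 0 :: profileOf N fun k => z (k + 1) := by
  rw [profileOf, List.range_succ_eq_map, List.map_cons, List.map_map]
  rfl

theorem exists_profileOf_eq_cons (N : ℕ) (z : ℕ → ℝ) : ∃ l, profileOf N z = z 0 :: l := by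
  cases N with
  | zero => exact ⟨[], rfl⟩
  | succ N => exact ⟨_, profileOf_succ N z⟩

theorem profileOf_neg (N : ℕ) (z : ℕ → ℝ) :
    profileOf N (fun n => -z n) = (profileOf N z).map (- ·) := by
  rw [profileOf, profileOf, List.map_map]
  rfl

theorem mem_profileOf {N : ℕ} {z : ℕ → ℝ} {x : ℝ} : x ∈ profileOf N z ↔ ∃ n ≤ N, z n = x := by
  simp [profileOf]

theorem spreadLE_profileOf {w : ℝ} {N : ℕ} {z : ℕ → ℝ}
    (hz : ∀ i ≤ N, ∀ j ≤ N, z i - z j ≤ w) : SpreadLE w (profileOf N z) := by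
  intro p hp q hq
  obtain ⟨i, hi, rfl⟩ := mem_profileOf.1 hp
  obtain ⟨j, hj, rfl⟩ := mem_profileOf.1 hq
  exact abs_sub_le_iff.2 ⟨hz i hi j hj, hz j hj i hi⟩

theorem spreadLE_profileOf_of_mem_Icc {lo hi w : ℝ} {N : ℕ} {z : ℕ → ℝ}
    (hz : ∀ n ≤ N, z n ∈ Set.Icc lo hi) (hw : hi - lo ≤ w) : SpreadLE w (profileOf N z) :=
  spreadLE_profileOf fun i hi j hj => by linarith [(hz i hi).2, (hz j hj).1]

theorem stopDown_profileOf (t β : ℝ) (N : ℕ) (z : ℕ → ℝ) :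
    stopDown t β (profileOf N z) =
      ∑ n ∈ Finset.range N, max (stopState t β z n - stopState t β z (n + 1)) 0 := by
  induction N generalizing β z with
  | zero => simp [profileOf, stopDown]
  | succ N ih =>
    obtain ⟨l, hl⟩ := exists_profileOf_eq_cons N fun k => z (k + 1)
    have tail_eq := ih (clampTo t (β + (z 1 - z 0))) fun k => z (k + 1)
    rw [profileOf_succ, Finset.sum_range_succ']
    rw [hl] at tail_eq ⊢
    simp only [zero_add] at tail_eq ⊢
    rw [stopDown, tail_eq, add_comm]
    simp only [stopState_shift t β z]
    rfl

theorem stopState_mem {t β : ℝ} (hβ : β ∈ Set.Icc 0 t) (z : ℕ → ℝ) (n : ℕ) :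
    stopState t β z n ∈ Set.Icc 0 t := by
  cases n with
  | zero => exact hβ
  | succ n => exact clampTo_mem (hβ.1.trans hβ.2) _

section Full

variable {t : ℝ} (ht : 0 ≤ t) {z : ℕ → ℝ}
include ht

theorem stopState_full_mem (z : ℕ → ℝ) (n : ℕ) : stopState t t z n ∈ Set.Icc 0 t :=
  stopState_mem ⟨ht, le_rfl⟩ z n

/-- Emptying the stop operator down to a lower bound of the sequence loses only room that the
sequence never uses. -/
theorem min_stopState_sub_eq {lo : ℝ} {N : ℕ} (hz : ∀ n ≤ N, lo ≤ z n) :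
    ∀ n ≤ N, min (stopState t t z n) (z n - lo) = stopState t (min t (z 0 - lo)) z n := by
  intro n hn
  induction n with
  | zero => rfl
  | succ n ih =>
    have hB := stopState_full_mem ht z n
    have := hz n (by omega)
    have := hz (n + 1) hn
    rw [stopState, stopState, ← ih (by omega)]
    simp only [clampTo, Set.mem_Icc] at *
    grind

theorem stopDown_full_eq {lo : ℝ} {N : ℕ} (hz : ∀ n ≤ N, lo ≤ z n) :
    stopDown t t (profileOf N z) = stopDown t (min t (z 0 - lo)) (profileOf N z) := by
  rw [stopDown_profileOf, stopDown_profileOf]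
  refine Finset.sum_congr rfl fun n hn => ?_
  have hn := Finset.mem_range.1 hn
  have hB := stopState_full_mem ht z n
  have := hz n hn.le
  have := hz (n + 1) hn
  rw [← min_stopState_sub_eq ht hz n hn.le, ← min_stopState_sub_eq ht hz (n + 1) hn, stopState]
  simp only [clampTo, Set.mem_Icc] at *
  grind

theorem sub_le_stopState {M : ℝ} {n : ℕ} (hM : ∀ k ≤ n, z k ≤ M) :
    t - (M - z n) ≤ stopState t t z n := by
  induction n with
  | zero => simpa [stopState] using hM 0 le_rfl
  | succ n ih =>
    have h := hM (n + 1) le_rfl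
    have := ih fun k hk => hM k (by omega)
    simp only [stopState, clampTo]
    grind

theorem stopState_le {m : ℝ} {n : ℕ} (hm : ∀ k ≤ n, m ≤ z k) {i : ℕ} (hi : i ≤ n) :
    stopState t t z n ≤ max (z n - m) (t - (z i - z n)) := by
  induction n with
  | zero =>
    obtain rfl : i = 0 := by omega
    simp [stopState]
  | succ n ih =>
    have h := hm (n + 1) le_rfl
    rcases hi.eq_or_lt with rfl | hi
    · rw [sub_self, sub_zero]
      exact (stopState_full_mem ht z _).2.trans (le_max_right _ _)
    · have := ih (fun k hk => hm k (by omega)) (by omega)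
      simp only [stopState, clampTo]
      grind

theorem stopDown_eq_of_wide {lo hi : ℝ} (hw : hi - lo ≤ t) {N : ℕ}
    (hz : ∀ n ≤ N, z n ∈ Set.Icc lo hi) :
    stopDown t t (profileOf N z) = ∑ n ∈ Finset.range N, max (z n - z (n + 1)) 0 := by
  rw [stopDown_profileOf]
  refine Finset.sum_congr rfl fun n hn => ?_
  have hn := Finset.mem_range.1 hn
  have hB := stopState_full_mem ht z n
  have hlow := sub_le_stopState ht (z := z) (n := n) fun k hk => (hz k (by omega)).2
  have hz' := hz (n + 1) hn
  rw [stopState]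
  simp only [clampTo, Set.mem_Icc] at *
  grind

end Full

/-! ### Paths that follow an instruction -/

/-- A path in `[lo, hi]` whose range is at most `u` and which follows the instructed steps `ρ`
unless stopped by one of these limits. -/
structure ThresholdPath (u lo hi : ℝ) (N : ℕ) (ρ y : ℕ → ℝ) : Prop where
  mem : ∀ n ≤ N, y n ∈ Set.Icc lo hi
  range : ∀ i ≤ N, ∀ j ≤ N, y i - y j ≤ u
  up : ∀ n < N, 0 ≤ ρ n → y n ≤ y (n + 1) ∧ y (n + 1) ≤ y n + ρ n ∧
    (y (n + 1) = y n + ρ n ∨ y (n + 1) = hi ∨ ∃ j ≤ n, y (n + 1) = y j + u)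
  down : ∀ n < N, ρ n ≤ 0 → y (n + 1) ≤ y n ∧ y n + ρ n ≤ y (n + 1) ∧
    (y (n + 1) = y n + ρ n ∨ y (n + 1) = lo ∨ ∃ j ≤ n, y (n + 1) = y j - u)

/-- A path in `[lo, hi]` that exceeds the instructed steps `ρ` by at most `o`. -/
structure ResponsePath (lo hi : ℝ) (N : ℕ) (ρ o z : ℕ → ℝ) : Prop where
  mem : ∀ n ≤ N, z n ∈ Set.Icc lo hi
  nonneg : ∀ n < N, 0 ≤ o n
  up : ∀ n < N, 0 ≤ ρ n → -o n ≤ z (n + 1) - z n ∧ z (n + 1) - z n ≤ ρ n + o n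
  down : ∀ n < N, ρ n ≤ 0 → ρ n - o n ≤ z (n + 1) - z n ∧ z (n + 1) - z n ≤ o n

theorem ThresholdPath.neg {u lo hi : ℝ} {N : ℕ} {ρ y : ℕ → ℝ} (h : ThresholdPath u lo hi N ρ y) :
    ThresholdPath u (-hi) (-lo) N (fun n => -ρ n) fun n => -y n where
  mem n hn := ⟨neg_le_neg (h.mem n hn).2, neg_le_neg (h.mem n hn).1⟩
  range i hi j hj := by linarith [h.range j hj i hi]
  up n hn hρ := by
    obtain ⟨h_mono, h_le, h_stop⟩ := h.down n hn (by linarith)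
    refine ⟨by linarith, by linarith, ?_⟩
    rcases h_stop with h | h | ⟨j, hj, h⟩
    · exact Or.inl (by linarith)
    · exact Or.inr (Or.inl (by linarith))
    · exact Or.inr (Or.inr ⟨j, hj, by linarith⟩)
  down n hn hρ := by
    obtain ⟨h_mono, h_le, h_stop⟩ := h.up n hn (by linarith)
    refine ⟨by linarith, by linarith, ?_⟩
    rcases h_stop with h | h | ⟨j, hj, h⟩
    · exact Or.inl (by linarith)
    · exact Or.inr (Or.inl (by linarith))
    · exact Or.inr (Or.inr ⟨j, hj, by linarith⟩)

theorem ThresholdPath.rescale {u lo hi E : ℝ} {N : ℕ} {ρ y : ℕ → ℝ}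
    (hy : ThresholdPath (u * E) lo hi N ρ y) (hE : 0 < E) (e : ℝ) :
    ThresholdPath u ((lo - e) / E) ((hi - e) / E) N (fun n => ρ n / E)
      (fun n => (y n - e) / E) where
  mem n hn := by
    obtain ⟨h₁, h₂⟩ := hy.mem n hn
    exact ⟨by gcongr, by gcongr⟩
  range i hi j hj := by
    rw [← sub_div, div_le_iff₀ hE, sub_sub_sub_cancel_right]
    exact hy.range i hi j hj
  up n hn hρ := by
    have hE' := hE.ne'
    obtain ⟨h₁, h₂, h₃⟩ := hy.up n hn (by simpa using (le_div_iff₀ hE).1 hρ)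
    refine ⟨by gcongr, by rw [← add_div]; gcongr; linarith, h₃.imp ?_ (.imp ?_ ?_)⟩
    · intro h; rw [h]; ring
    · intro h; rw [h]
    · rintro ⟨j, hj, h⟩; exact ⟨j, hj, by rw [h]; field_simp; ring⟩
  down n hn hρ := by
    have hE' := hE.ne'
    obtain ⟨h₁, h₂, h₃⟩ := hy.down n hn (by simpa using (div_le_iff₀ hE).1 hρ)
    refine ⟨by gcongr, by rw [← add_div]; gcongr; linarith, h₃.imp ?_ (.imp ?_ ?_)⟩
    · intro h; rw [h]; ring
    · intro h; rw [h]
    · rintro ⟨j, hj, h⟩; exact ⟨j, hj, by rw [h]; field_simp; ring⟩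

theorem ResponsePath.neg {lo hi : ℝ} {N : ℕ} {ρ o z : ℕ → ℝ} (h : ResponsePath lo hi N ρ o z) :
    ResponsePath (-hi) (-lo) N (fun n => -ρ n) o fun n => -z n where
  mem n hn := ⟨neg_le_neg (h.mem n hn).2, neg_le_neg (h.mem n hn).1⟩
  nonneg := h.nonneg
  up n hn hρ := by
    have := h.down n hn (by linarith)
    constructor <;> linarith
  down n hn hρ := by
    have := h.up n hn (by linarith)
    constructor <;> linarith

section StopStep

variable {t b b' ρ o ξ ξ' E : ℝ} (hb : b ∈ Set.Icc 0 t) (hb' : b' ∈ Set.Icc 0 t)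
  (ho : 0 ≤ o) (hE : max (b - b') 0 ≤ E)
include hb hb' ho hE

theorem max_stop_sub_le_up (h_lo : -o ≤ ξ) (h_hi : ξ ≤ ρ + o)
    (h : ξ' = ρ ∨ clampTo t (b + ξ) ≤ clampTo t (b' + ξ')) :
    max (clampTo t (b + ξ) - clampTo t (b' + ξ')) 0 ≤
      E + (max (b' - clampTo t (b' + ξ')) 0 - max (b - clampTo t (b + ξ)) 0 + o) := by
  simp only [clampTo, Set.mem_Icc] at *
  grind

theorem max_stop_sub_le_down (h_lo : ρ - o ≤ ξ) (h_hi : ξ ≤ o)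
    (h : ξ' = ρ ∨ clampTo t (b' + ξ') = 0) :
    max (clampTo t (b + ξ) - clampTo t (b' + ξ')) 0 ≤
      E + (max (b' - clampTo t (b' + ξ')) 0 - max (b - clampTo t (b + ξ)) 0 + o) := by
  simp only [clampTo, Set.mem_Icc] at *
  grind

end StopStep

section Comparison

variable {u lo hi t : ℝ} {N : ℕ} {ρ o y z : ℕ → ℝ}

theorem ThresholdPath.min_le_stopState_of_blocked (hy : ThresholdPath u lo hi N ρ y)
    (ht : t ∈ Set.Icc 0 u) {n : ℕ} (hn : n < N)
    (h : y (n + 1) = hi ∨ ∃ j ≤ n, y (n + 1) = y j + u) :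
    min t (hi - lo) ≤ stopState t (min t (y 0 - lo)) y (n + 1) := by
  have hlo : ∀ n ≤ N, lo ≤ y n := fun n hn => (hy.mem n hn).1
  have hmax : ∀ k ≤ n + 1, y k ≤ y (n + 1) := by
    intro k hk
    rcases h with h | ⟨j, hj, h⟩
    · exact h ▸ (hy.mem k (by omega)).2
    · linarith [hy.range k (by omega) j (by omega)]
  have hB := sub_le_stopState ht.1 hmax
  rw [sub_self, sub_zero] at hB
  rw [← min_stopState_sub_eq ht.1 hlo (n + 1) hn]
  refine le_min ((min_le_left _ _).trans hB) ?_
  rcases h with h | ⟨j, hj, h⟩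
  · exact h ▸ min_le_right _ _
  · exact (min_le_left _ _).trans (by linarith [hlo j (by omega), ht.2])

theorem ThresholdPath.stopState_eq_zero_of_blocked (hy : ThresholdPath u lo hi N ρ y)
    (ht : t ∈ Set.Icc 0 u) {n : ℕ} (hn : n < N)
    (h : y (n + 1) = lo ∨ ∃ j ≤ n, y (n + 1) = y j - u) :
    stopState t (min t (y 0 - lo)) y (n + 1) = 0 := by
  have hlo : ∀ n ≤ N, lo ≤ y n := fun n hn => (hy.mem n hn).1
  have hB := (stopState_full_mem ht.1 y (n + 1)).1
  rw [← min_stopState_sub_eq ht.1 hlo (n + 1) hn]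
  rcases h with h | ⟨j, hj, h⟩
  · rw [h, sub_self, min_eq_right hB]
  · have hmin : ∀ k ≤ n + 1, y (n + 1) ≤ y k := fun k hk => by
      linarith [hy.range j (by omega) k (by omega)]
    have hle := stopState_le ht.1 hmin (i := j) (by omega)
    rw [sub_self, max_eq_left (by linarith [ht.2])] at hle
    rw [min_eq_left (by linarith [hlo (n + 1) hn])]
    exact le_antisymm hle hB

theorem ResponsePath.stopState_le_min (hz : ResponsePath lo hi N ρ o z) (ht : 0 ≤ t) {n : ℕ}
    (hn : n ≤ N) : stopState t (min t (z 0 - lo)) z n ≤ min t (hi - lo) := by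
  rw [← min_stopState_sub_eq ht (fun n hn => (hz.mem n hn).1) n hn]
  exact min_le_min (stopState_full_mem ht z n).2 (by linarith [(hz.mem n hn).2])

/-- Whatever the response has in store beyond the threshold path, it has paid for by moving less
downwards so far. -/
theorem ThresholdPath.max_stopState_sub_le (hy : ThresholdPath u lo hi N ρ y)
    (hz : ResponsePath lo hi N ρ o z) (h0 : y 0 = z 0) (ht : t ∈ Set.Icc 0 u) {β : ℝ}
    (hβ : β = min t (y 0 - lo)) : ∀ n ≤ N,
    max (stopState t β z n - stopState t β y n) 0 ≤ ∑ k ∈ Finset.range n,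
      (max (stopState t β y k - stopState t β y (k + 1)) 0 -
        max (stopState t β z k - stopState t β z (k + 1)) 0 + o k) := by
  have hβ_mem : β ∈ Set.Icc 0 t :=
    hβ ▸ ⟨le_min ht.1 (by linarith [(hy.mem 0 (Nat.zero_le _)).1]), min_le_left _ _⟩
  intro n hn
  induction n with
  | zero => simp [stopState]
  | succ n ih =>
    have hbz := stopState_mem hβ_mem z n
    have hby := stopState_mem hβ_mem y n
    have ho := hz.nonneg n hn
    have hE := ih (by omega)
    rw [Finset.sum_range_succ]
    rcases le_total 0 (ρ n) with hρ | hρ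
    · obtain ⟨-, -, h_stop⟩ := hy.up n hn hρ
      obtain ⟨h_lo, h_hi⟩ := hz.up n hn hρ
      refine max_stop_sub_le_up hbz hby ho hE h_lo h_hi ?_
      rcases h_stop with h | h
      · exact Or.inl (by linarith)
      · have top : stopState t β z (n + 1) ≤ min t (hi - lo) :=
          hβ ▸ h0 ▸ hz.stopState_le_min ht.1 hn
        exact Or.inr (top.trans (hβ ▸ hy.min_le_stopState_of_blocked ht hn h))
    · obtain ⟨-, -, h_stop⟩ := hy.down n hn hρ
      obtain ⟨h_lo, h_hi⟩ := hz.down n hn hρ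
      refine max_stop_sub_le_down hbz hby ho hE h_lo h_hi ?_
      rcases h_stop with h | h
      · exact Or.inl (by linarith)
      · exact Or.inr (hβ ▸ hy.stopState_eq_zero_of_blocked ht hn h)

theorem ThresholdPath.stopDown_le (hy : ThresholdPath u lo hi N ρ y)
    (hz : ResponsePath lo hi N ρ o z) (h0 : y 0 = z 0) (ht : t ∈ Set.Icc 0 u) :
    stopDown t t (profileOf N z) ≤
      stopDown t t (profileOf N y) + ∑ n ∈ Finset.range N, o n := by
  have := (le_max_right _ _).trans (hy.max_stopState_sub_le hz h0 ht rfl N le_rfl)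
  rw [Finset.sum_add_distrib, Finset.sum_sub_distrib] at this
  rw [stopDown_full_eq ht.1 fun n hn => (hy.mem n hn).1,
    stopDown_full_eq ht.1 fun n hn => (hz.mem n hn).1, ← h0, stopDown_profileOf,
    stopDown_profileOf]
  linarith

theorem ThresholdPath.truncatedSumsLE_downs (hy : ThresholdPath u lo hi N ρ y)
    (hz : ResponsePath lo hi N ρ o z) (h0 : y 0 = z 0) :
    TruncatedSumsLE u (∑ n ∈ Finset.range N, o n) (rainflow (profileOf N z)).downs
      (rainflow (profileOf N y)).downs := by
  intro t ht
  rw [sum_min_downs ht.1, sum_min_downs ht.1]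
  exact hy.stopDown_le hz h0 ht

theorem ThresholdPath.truncatedSumsLE_ups (hy : ThresholdPath u lo hi N ρ y)
    (hz : ResponsePath lo hi N ρ o z) (h0 : y 0 = z 0) :
    TruncatedSumsLE u (∑ n ∈ Finset.range N, o n) (rainflow (profileOf N z)).ups
      (rainflow (profileOf N y)).ups := by
  simpa only [profileOf_neg, downs_rainflow_neg] using
    hy.neg.truncatedSumsLE_downs hz.neg (congrArg Neg.neg h0)

theorem ThresholdPath.strokeCost_le {v w Kf Kg : ℝ} {f g : ℝ → ℝ} (hy : ThresholdPath u lo hi N ρ y)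
    (hz : ResponsePath lo hi N ρ o z) (h0 : y 0 = z 0) (hlh : hi - lo ≤ 1)
    (p : StrokePrices f g u v w) (hKf : 0 ≤ Kf) (hKg : 0 ≤ Kg)
    (hfK : ∀ t ∈ Set.Icc (0 : ℝ) 1, -(Kf * t) ≤ f t)
    (hgK : ∀ t ∈ Set.Icc (0 : ℝ) 1, -(Kg * t) ≤ g t) :
    strokeCost f g (profileOf N y) ≤ strokeCost f g (profileOf N z) +
      (Kf + Kg) * ∑ n ∈ Finset.range N, o n + (2 * (f u - f v) + (g u - g w)) :=
  p.sum_le_sum_add_gap hKf hKg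
    (Finset.sum_nonneg fun n hn => hz.nonneg n (Finset.mem_range.1 hn)) hfK hgK
    ((spreadLE_profileOf_of_mem_Icc hz.mem hlh).balanced zero_le_one)
    ((spreadLE_profileOf hy.range).balanced p.add_mem.1)
    (hy.truncatedSumsLE_ups hz h0) (hy.truncatedSumsLE_downs hz h0)

end Comparison

theorem sum_downs_profileOf {lo hi : ℝ} (hlh : lo ≤ hi) {N : ℕ} {z : ℕ → ℝ}
    (hz : ∀ n ≤ N, z n ∈ Set.Icc lo hi) :
    (rainflow (profileOf N z)).downs.sum = ∑ n ∈ Finset.range N, max (z n - z (n + 1)) 0 := by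
  have hw : 0 ≤ hi - lo := sub_nonneg.2 hlh
  have min_eq : ∀ x ∈ (rainflow (profileOf N z)).downs, min x (hi - lo) = x := fun x hx =>
    min_eq_left ((spreadLE_profileOf_of_mem_Icc hz le_rfl).downs_mem_Icc x hx).2
  rw [← stopDown_eq_of_wide hw le_rfl hz, ← sum_min_downs hw, List.map_congr_left min_eq,
    List.map_id']

theorem sum_ups_profileOf {lo hi : ℝ} (hlh : lo ≤ hi) {N : ℕ} {z : ℕ → ℝ}
    (hz : ∀ n ≤ N, z n ∈ Set.Icc lo hi) :
    (rainflow (profileOf N z)).ups.sum = ∑ n ∈ Finset.range N, max (z (n + 1) - z n) 0 := by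
  simpa only [profileOf_neg, downs_rainflow_neg, neg_sub_neg] using
    sum_downs_profileOf (neg_le_neg hlh) (N := N) (z := fun n => -z n) fun n hn =>
      ⟨neg_le_neg (hz n hn).2, neg_le_neg (hz n hn).1⟩

/-! ### Profiles with three monotone phases -/

theorem localExtrema_cons_remove {p a b c : ℝ} (h : (a ≤ b ∧ b ≤ c) ∨ (c ≤ b ∧ b ≤ a))
    (l : List ℝ) :
    localExtrema (p :: a :: b :: c :: l) = localExtrema (p :: a :: c :: l) := by
  have tail : localExtrema (a :: b :: c :: l) = localExtrema (a :: c :: l) := by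
    rw [localExtrema, if_pos h]
  rw [localExtrema, localExtrema.eq_4 p a c, tail, localExtrema.eq_4 p b c]
  grind

theorem localExtrema_append_remove {a b c : ℝ} (h : (a ≤ b ∧ b ≤ c) ∨ (c ≤ b ∧ b ≤ a))
    (l₁ l₂ : List ℝ) :
    localExtrema (l₁ ++ a :: b :: c :: l₂) = localExtrema (l₁ ++ a :: c :: l₂) := by
  induction hn : l₁.length generalizing l₁ with
  | zero =>
    rw [List.length_eq_zero_iff.1 hn, List.nil_append, List.nil_append, localExtrema, if_pos h]
  | succ n ih =>
    match l₁, hn with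
    | [p], _ => exact localExtrema_cons_remove h l₂
    | [p, q], hn =>
      have remove_p := ih [q] (by grind)
      have remove_q := ih [p] (by grind)
      simp only [List.cons_append, List.nil_append] at remove_p remove_q ⊢
      rw [localExtrema, localExtrema.eq_4 p q a, remove_p, remove_q]
    | p :: q :: s :: l, hn =>
      have remove_p := ih (q :: s :: l) (by grind)
      have remove_q := ih (p :: s :: l) (by grind)
      simp only [List.cons_append] at remove_p remove_q ⊢
      rw [localExtrema, localExtrema.eq_4 p q s, remove_p, remove_q]

theorem localExtrema_append_run {z : ℕ → ℝ} {i k : ℕ} (hk : 0 < k)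
    (h : MonotoneOn z (Set.Icc i (i + k)) ∨ AntitoneOn z (Set.Icc i (i + k)))
    (l₁ l₂ : List ℝ) :
    localExtrema (l₁ ++ z i :: ((List.range' (i + 1) k).map z ++ l₂)) =
      localExtrema (l₁ ++ z i :: z (i + k) :: l₂) := by
  induction k, hk using Nat.le_induction generalizing l₂ with
  | base => rfl
  | succ k _ ih =>
    have hsub : Set.Icc i (i + k) ⊆ Set.Icc i (i + (k + 1)) :=
      Set.Icc_subset_Icc_right (by omega)
    rw [List.range'_1_concat, List.map_append, List.append_assoc,
      ih (h.imp (·.mono hsub) (·.mono hsub)), show i + (k + 1) = i + 1 + k by ring]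
    refine localExtrema_append_remove ?_ _ _
    grind [MonotoneOn, AntitoneOn]

theorem profileOf_add (m n : ℕ) (z : ℕ → ℝ) :
    profileOf (m + n) z = profileOf m z ++ (List.range' (m + 1) n).map z := by
  rw [profileOf, profileOf, ← List.map_append, List.range_eq_range', List.range_eq_range',
    add_right_comm, ← List.range'_append_1, zero_add]

theorem localExtrema_profileOf_three_phases {z : ℕ → ℝ} {K : ℕ} (hK : 0 < K)
    (h_rise : MonotoneOn z (Set.Icc 0 K)) (h_fall : AntitoneOn z (Set.Icc K (2 * K)))
    (h_rise' : MonotoneOn z (Set.Icc (2 * K) (3 * K))) :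
    localExtrema (profileOf (3 * K) z) = localExtrema [z 0, z K, z (2 * K), z (3 * K)] := by
  have h₂ : 2 * K = K + K := two_mul K
  have h₃ : 3 * K = K + K + K := by ring
  rw [h₂] at h_fall h_rise'
  rw [h₃] at h_rise'
  have run₁ := localExtrema_append_run (i := 0) hK (.inl ((zero_add K).symm ▸ h_rise)) []
  have run₂ := localExtrema_append_run hK (.inr h_fall) [z 0]
  have run₃ := localExtrema_append_run hK (.inl h_rise') [z 0, z K] []
  simp only [List.nil_append, List.cons_append, List.append_nil, zero_add] at run₁ run₂ run₃
  rw [h₂, h₃, profileOf_add, profileOf_add, ← Nat.zero_add K, profileOf_add]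
  simp only [profileOf, List.range_one, List.map_cons, List.map_nil, List.cons_append,
    List.nil_append, List.append_assoc, zero_add]
  rw [run₁, run₂, run₃]

theorem strokeCost_congr {l l' : List ℝ} (h : localExtrema l = localExtrema l') (f g : ℝ → ℝ) :
    strokeCost f g l = strokeCost f g l' := by
  simp only [strokeCost, rainflow, h]

theorem strokeCost_up_down_up {p q : ℝ} (hp : 0 ≤ p) (hpq : p ≤ q) {f g : ℝ → ℝ} (f0 : f 0 = 0)
    (g0 : g 0 = 0) : strokeCost f g [0, p, p - q, 2 * p - q] = 2 * f p + g q := by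
  rcases hp.eq_or_lt with rfl | hp
  · rcases hpq.eq_or_lt with rfl | hq
    · simp [strokeCost, rainflow, localExtrema, rainflowSweeps, rainflowSweep, chargeHalfCycles,
        dischargeHalfCycles, Cycles.ups, Cycles.downs, f0, g0]
    · simp [strokeCost, rainflow, localExtrema, rainflowSweeps, rainflowSweep, chargeHalfCycles,
        dischargeHalfCycles, Cycles.ups, Cycles.downs, f0, hq, hq.le, hq.ne', hq.not_gt]
  have extrema : localExtrema [0, p, p - q, 2 * p - q] = [0, p, p - q, 2 * p - q] := by
    simp only [localExtrema]
    grind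
  have depth₁ : |0 - p| = p := by rw [zero_sub, abs_neg, abs_of_pos hp]
  have depth₂ : |p - (p - q)| = q := by rw [sub_sub_cancel, abs_of_pos (hp.trans_le hpq)]
  have depth₃ : |p - q - (2 * p - q)| = p := by
    rw [show p - q - (2 * p - q) = -p by ring, abs_neg, abs_of_pos hp]
  rcases hpq.eq_or_lt with rfl | hq
  · have sweep : rainflowSweep [0, p, p - p, 2 * p - p] = ([p], [0, 2 * p - p]) := by
      rw [rainflowSweep, depth₁, depth₂, depth₃]
      simp [rainflowSweep]
    rw [strokeCost, rainflow, extrema]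
    simp only [List.length_cons, List.length_nil, rainflowSweeps, sweep]
    simp [rainflowSweep, chargeHalfCycles, dischargeHalfCycles, Cycles.ups, Cycles.downs, hp,
      hp.not_gt, two_mul]
  · have sweep : rainflowSweep [0, p, p - q, 2 * p - q] = ([], [0, p, p - q, 2 * p - q]) := by
      rw [rainflowSweep, depth₁, depth₂, depth₃, if_neg (by simp [hq])]
      simp [rainflowSweep]
    rw [strokeCost, rainflow, extrema]
    simp only [List.length_cons, List.length_nil, rainflowSweeps, sweep]
    simp only [Cycles.ups, Cycles.downs, chargeHalfCycles, dischargeHalfCycles, List.nil_append,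
      List.append_nil]
    grind

section UpDownUp

/-- The path that goes up by `p`, down by `q` and up by `p` again, in `K` equal steps each. The
worst-case instructions and the optimal responses to them are of this shape. -/
def upDownUp (K : ℕ) (p q : ℝ) (n : ℕ) : ℝ :=
  if n ≤ K then n * (p / K)
  else if n ≤ 2 * K then p - (n - K) * (q / K)
  else p - q + (n - 2 * K) * (p / K)

variable {K : ℕ} (hK : 0 < K) {p q : ℝ}

theorem upDownUp_zero : upDownUp K p q 0 = 0 := by simp [upDownUp]

include hK

theorem upDownUp_top : upDownUp K p q K = p := by
  rw [upDownUp, if_pos le_rfl]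
  field_simp

theorem upDownUp_bottom : upDownUp K p q (2 * K) = p - q := by
  rw [upDownUp, if_neg (by omega), if_pos le_rfl]
  push_cast
  field_simp
  ring

theorem upDownUp_end : upDownUp K p q (3 * K) = 2 * p - q := by
  rw [upDownUp, if_neg (by omega), if_neg (by omega)]
  push_cast
  field_simp
  ring

theorem upDownUp_step (n : ℕ) : upDownUp K p q (n + 1) - upDownUp K p q n =
    if n < K then p / K else if n < 2 * K then -(q / K) else p / K := by
  have : (K : ℝ) ≠ 0 := by positivity
  have hp : (K : ℝ) * (p / K) = p := mul_div_cancel₀ p this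
  have hq : (K : ℝ) * (q / K) = q := mul_div_cancel₀ q this
  have cast_top : n = K → (n : ℝ) = K := by rintro rfl; rfl
  have cast_bottom : n = 2 * K → (n : ℝ) = 2 * K := by rintro rfl; push_cast; rfl
  simp only [upDownUp]
  grind

theorem upDownUp_le_succ (hp : 0 ≤ p) {n : ℕ} (hn : n < K ∨ 2 * K ≤ n) :
    upDownUp K p q n ≤ upDownUp K p q (n + 1) := by
  have : 0 ≤ p / K := by positivity
  have := upDownUp_step (p := p) (q := q) hK n
  grind

theorem upDownUp_succ_le (hq : 0 ≤ q) {n : ℕ} (hn : K ≤ n) (hn' : n < 2 * K) :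
    upDownUp K p q (n + 1) ≤ upDownUp K p q n := by
  have : 0 ≤ q / K := by positivity
  have := upDownUp_step (p := p) (q := q) hK n
  grind

theorem upDownUp_monotoneOn_first (hp : 0 ≤ p) : MonotoneOn (upDownUp K p q) (Set.Icc 0 K) :=
  monotoneOn_of_le_add_one Set.ordConnected_Icc fun _ _ _ hn =>
    upDownUp_le_succ hK hp (.inl hn.2)

theorem upDownUp_antitoneOn (hq : 0 ≤ q) : AntitoneOn (upDownUp K p q) (Set.Icc K (2 * K)) :=
  antitoneOn_of_add_one_le Set.ordConnected_Icc fun _ _ hn hn' =>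
    upDownUp_succ_le hK hq hn.1 hn'.2

theorem upDownUp_monotoneOn_last (hp : 0 ≤ p) :
    MonotoneOn (upDownUp K p q) (Set.Icc (2 * K) (3 * K)) :=
  monotoneOn_of_le_add_one Set.ordConnected_Icc fun _ _ hn _ =>
    upDownUp_le_succ hK hp (.inr hn.1)

theorem upDownUp_mem (hp : 0 ≤ p) (hpq : p ≤ q) {n : ℕ} (hn : n ≤ 3 * K) :
    upDownUp K p q n ∈ Set.Icc (p - q) p := by
  have rise := upDownUp_monotoneOn_first (q := q) hK hp
  have fall := upDownUp_antitoneOn (p := p) hK (hp.trans hpq)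
  have rise' := upDownUp_monotoneOn_last (q := q) hK hp
  have start := upDownUp_zero (K := K) (p := p) (q := q)
  have top := upDownUp_top (p := p) (q := q) hK
  have bottom := upDownUp_bottom (p := p) (q := q) hK
  have last := upDownUp_end (p := p) (q := q) hK
  grind [MonotoneOn, AntitoneOn]

theorem upDownUp_step_mem (hp : p ∈ Set.Icc (0 : ℝ) 1) (hq : q ∈ Set.Icc (0 : ℝ) 1) (n : ℕ) :
    upDownUp K p q (n + 1) - upDownUp K p q n ∈ Set.Icc (-(1 / K) : ℝ) (1 / K) := by
  have mem (x : ℝ) (hx : x ∈ Set.Icc (0 : ℝ) 1) : x / K ∈ Set.Icc (0 : ℝ) (1 / K) :=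
    ⟨div_nonneg hx.1 (Nat.cast_nonneg K), by gcongr; exact hx.2⟩
  have := mem p hp
  have := mem q hq
  rw [upDownUp_step hK]
  grind

theorem upDownUp_step_mem_uIcc {p' : ℝ} (hp : 0 ≤ p) (hpp' : p ≤ p') (hq : 0 ≤ q) (n : ℕ) :
    upDownUp K p q (n + 1) - upDownUp K p q n ∈
      Set.uIcc 0 (upDownUp K p' q (n + 1) - upDownUp K p' q n) := by
  have : 0 ≤ p / K := by positivity
  have : p / K ≤ p' / K := by gcongr
  have : 0 ≤ q / K := by positivity
  rw [upDownUp_step hK, upDownUp_step hK, Set.mem_uIcc]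
  grind

theorem strokeCost_upDownUp (hp : 0 ≤ p) (hpq : p ≤ q) {f g : ℝ → ℝ} (f0 : f 0 = 0)
    (g0 : g 0 = 0) : strokeCost f g (profileOf (3 * K) (upDownUp K p q)) = 2 * f p + g q := by
  rw [strokeCost_congr (localExtrema_profileOf_three_phases hK (upDownUp_monotoneOn_first hK hp)
      (upDownUp_antitoneOn hK (hp.trans hpq)) (upDownUp_monotoneOn_last hK hp)), upDownUp_zero,
    upDownUp_top hK, upDownUp_bottom hK, upDownUp_end hK, strokeCost_up_down_up hp hpq f0 g0]

end UpDownUp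

theorem ThresholdPath.eq_add_min_sum {u lo hi : ℝ} {N : ℕ} {ρ y : ℕ → ℝ} {s k : ℕ}
    (hy : ThresholdPath u lo hi N ρ y) (hu : 0 ≤ u) (hmin : ∀ i ≤ s, y s ≤ y i)
    (hhi : y s + u ≤ hi) (hsk : s + k ≤ N) (hρ : ∀ j < k, 0 ≤ ρ (s + j)) :
    y (s + k) = y s + min u (∑ j ∈ Finset.range k, ρ (s + j)) := by
  have rises : ∀ j ≤ k, y s ≤ y (s + j) := by
    intro j hj
    induction j with
    | zero => rfl
    | succ j ih => exact (ih (by omega)).trans (hy.up (s + j) (by omega) (hρ j hj)).1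
  have lowest : ∀ i ≤ s + k, y s ≤ y i := by
    intro i hi
    rcases le_total i s with h | h
    · exact hmin i h
    · exact Nat.add_sub_cancel' h ▸ rises (i - s) (by omega)
  induction k with
  | zero => simp [hu]
  | succ k ih =>
    have eq := ih (by omega) (fun j hj => hρ j (by omega)) (fun j hj => rises j (by omega))
      fun i hi => lowest i (by omega)
    have step_nonneg := hρ k k.lt_succ_self
    have step := hy.up (s + k) (by omega) step_nonneg
    have range := hy.range (s + k + 1) hsk s (by omega)
    rw [Finset.sum_range_succ, ← add_assoc]
    grind

theorem ThresholdPath.sub_min_sum_eq {u lo hi : ℝ} {N : ℕ} {ρ y : ℕ → ℝ} {s k : ℕ}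
    (hy : ThresholdPath u lo hi N ρ y) (hu : 0 ≤ u) (hmax : ∀ i ≤ s, y i ≤ y s)
    (hlo : lo ≤ y s - u) (hsk : s + k ≤ N) (hρ : ∀ j < k, ρ (s + j) ≤ 0) :
    y (s + k) = y s - min u (∑ j ∈ Finset.range k, -ρ (s + j)) := by
  linarith [hy.neg.eq_add_min_sum hu (fun i hi => neg_le_neg (hmax i hi)) (by linarith) hsk
    fun j hj => neg_nonneg.2 (hρ j hj)]

section ThresholdPath

variable {K : ℕ} {u w lo hi : ℝ} {y : ℕ → ℝ}
  (hy : ThresholdPath u lo hi (3 * K) (fun n => upDownUp K u w (n + 1) - upDownUp K u w n) y)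
  (hK : 0 < K) (hu : 0 ≤ u) (huw : u ≤ w) (hlo : lo ≤ 0) (hhi : u ≤ hi) (y0 : y 0 = 0)

include hy hK hu huw hlo hhi y0

theorem ThresholdPath.upDownUp_turns : y K = u ∧ y (2 * K) = 0 ∧ y (3 * K) = u := by
  have rise (n) (hn : n < K ∨ 2 * K ≤ n) := sub_nonneg.2 (upDownUp_le_succ (q := w) hK hu hn)
  have fall (n) (hn : K ≤ n) (hn' : n < 2 * K) :=
    sub_nonpos.2 (upDownUp_succ_le (p := u) hK (hu.trans huw) hn hn')
  have top : y K = u := by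
    have := hy.eq_add_min_sum (s := 0) (k := K) hu (by grind) (by linarith) (by omega) (by grind)
    simp only [zero_add, Finset.sum_range_sub] at this
    rw [this, y0, upDownUp_top hK, upDownUp_zero, sub_zero, min_self, zero_add]
  have nonneg (i) (hi : i ≤ 3 * K) : 0 ≤ y i := by linarith [hy.range K (by omega) i hi]
  have bottom : y (2 * K) = 0 := by
    have := hy.sub_min_sum_eq (s := K) (k := K) hu
      (fun i hi => by linarith [hy.range i (by omega) 0 (by omega)]) (by linarith) (by omega)
      fun j hj => fall _ (by omega) (by omega)
    simp only [Finset.sum_neg_distrib, add_assoc,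
      Finset.sum_range_sub fun j => upDownUp K u w (K + j)] at this
    rw [two_mul, this, top, add_zero, ← two_mul, upDownUp_top hK, upDownUp_bottom hK,
      sub_sub_cancel_left, neg_neg, min_eq_left huw, sub_self]
  refine ⟨top, bottom, ?_⟩
  have := hy.eq_add_min_sum (s := 2 * K) (k := K) hu
    (fun i hi => bottom ▸ nonneg i (by omega)) (by linarith) (by omega) fun j _ => rise _ (by omega)
  simp only [add_assoc, Finset.sum_range_sub fun j => upDownUp K u w (2 * K + j)] at this
  rw [show 3 * K = 2 * K + K by ring, this, bottom, add_zero, upDownUp_bottom hK,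
    show 2 * K + K = 3 * K by ring, upDownUp_end hK, zero_add, min_eq_left (by linarith)]

theorem ThresholdPath.strokeCost_upDownUp {f g : ℝ → ℝ} (f0 : f 0 = 0) (g0 : g 0 = 0) :
    strokeCost f g (profileOf (3 * K) y) = 2 * f u + g u := by
  have rise (n) (hn : n < K ∨ 2 * K ≤ n) := sub_nonneg.2 (upDownUp_le_succ (q := w) hK hu hn)
  have fall (n) (hn : K ≤ n) (hn' : n < 2 * K) :=
    sub_nonpos.2 (upDownUp_succ_le (p := u) hK (hu.trans huw) hn hn')
  obtain ⟨top, bottom, last⟩ := hy.upDownUp_turns hK hu huw hlo hhi y0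
  have extrema := localExtrema_profileOf_three_phases (z := y) hK
    (monotoneOn_of_le_add_one Set.ordConnected_Icc fun n _ _ hn =>
      (hy.up n (by grind) (rise n (.inl hn.2))).1)
    (antitoneOn_of_add_one_le Set.ordConnected_Icc fun n _ hn hn' =>
      (hy.down n (by grind) (fall n hn.1 hn'.2)).1)
    (monotoneOn_of_le_add_one Set.ordConnected_Icc fun n _ hn hn' =>
      (hy.up n (by grind) (rise n (.inr hn.1))).1)
  rw [strokeCost_congr extrema, y0, top, bottom, last]
  have := strokeCost_up_down_up hu le_rfl f0 g0
  rwa [sub_self, two_mul, add_sub_cancel_right] at this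

end ThresholdPath

/-! ### Minimizers of perturbed strictly convex functions -/

theorem strictConvexOn_mul_sub_linear {φ : ℝ → ℝ} {s : Set ℝ} (hφ : StrictConvexOn ℝ s φ) {k : ℝ}
    (hk : 0 < k) (m : ℝ) : StrictConvexOn ℝ s fun x => k * φ x - m * x := by
  refine ⟨hφ.1, fun x hx y hy hxy a b ha hb hab => ?_⟩
  have := mul_lt_mul_of_pos_left (hφ.2 hx hy hxy ha hb hab) hk
  simp only [smul_eq_mul] at this ⊢
  linarith

theorem minimizer_le_of_add_linear {F G : ℝ → ℝ} {s : Set ℝ} {p q k : ℝ}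
    (hF : StrictConvexOn ℝ s F) (hk : 0 ≤ k) (hG : ∀ x, G x = F x + k * x) (hp : p ∈ s)
    (hq : q ∈ s) (hp_min : IsMinOn F s p) (hq_min : IsMinOn G s q) : q ≤ p := by
  by_contra! hlt
  have hFqp : F q ≤ F p := by
    have hGqp : G q ≤ G p := hq_min hp
    rw [hG, hG] at hGqp
    nlinarith
  have hq_min' : IsMinOn F s q := fun x hx => hFqp.trans (hp_min hx)
  exact hlt.ne (hF.eq_of_isMinOn hp_min hq_min' hp hq)

theorem StrokePrices.of_add_linear {f g : ℝ → ℝ} {u v w k : ℝ}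
    (hf : StrictConvexOn ℝ (Set.Icc 0 1) f) (hg : StrictConvexOn ℝ (Set.Icc 0 1) g)
    (f0 : f 0 = 0) (g0 : g 0 = 0) (hk : 0 ≤ k) (hfg : ∀ x, f x = g x + k * x)
    (hu : u ∈ Set.Icc (0 : ℝ) 1) (hv : v ∈ Set.Icc (0 : ℝ) 1) (hw : w ∈ Set.Icc (0 : ℝ) 1)
    (hu_min : IsMinOn (fun x => f x + g x) (Set.Icc 0 1) u)
    (hv_min : IsMinOn f (Set.Icc 0 1) v) (hw_min : IsMinOn g (Set.Icc 0 1) w) :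
    StrokePrices f g u v w where
  convexOn_left := hf.convexOn
  convexOn_right := hg.convexOn
  left_zero := f0
  right_zero := g0
  nonneg := hv.1
  le_left := minimizer_le_of_add_linear (G := f + f) (hf.add hg) hk
    (fun x => by simp only [Pi.add_apply]; linarith [hfg x]) hu hv hu_min (hv_min.add hv_min)
  le_right := minimizer_le_of_add_linear (F := g + g) (hg.add hg) hk
    (fun x => by simp only [Pi.add_apply]; linarith [hfg x]) hw hu (hw_min.add hw_min) hu_min
  le_one := hw.2
  isMinOn_add := hu_min
  isMinOn_left := hv_min
  isMinOn_right := hw_min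

/-! ### Overshoot over an instruction -/

/-- The distance of the response `b` to the interval between `0` and the instruction `a`. It
vanishes for responses within the instruction and enters the penalty of all others. -/
def overshoot (a b : ℝ) : ℝ := max (b - max a 0) 0 + max (min a 0 - b) 0

theorem overshoot_eq_zero {a b : ℝ} (h : b ∈ Set.uIcc 0 a) : overshoot a b = 0 := by
  rw [Set.mem_uIcc] at h
  grind [overshoot]

theorem overshoot_mul {k : ℝ} (hk : 0 ≤ k) (a b : ℝ) :
    overshoot (k * a) (k * b) = k * overshoot a b := by
  have pos (x : ℝ) : max (k * x) 0 = k * max x 0 := by rw [mul_max_of_nonneg _ _ hk, mul_zero]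
  have neg (x : ℝ) : min (k * x) 0 = k * min x 0 := by rw [mul_min_of_nonneg _ _ hk, mul_zero]
  simp only [overshoot, pos, neg, ← mul_sub, mul_add]

theorem max_add_max_sub (a b : ℝ) : max b 0 + max (a - b) 0 = max a 0 + overshoot a b := by
  grind [overshoot]

theorem max_neg_add_max_sub (a b : ℝ) :
    max (-b) 0 + max (b - a) 0 = max (-a) 0 + overshoot a b := by
  grind [overshoot]

theorem responsePath_overshoot {lo hi : ℝ} {N : ℕ} {z : ℕ → ℝ}
    (hz : ∀ n ≤ N, z n ∈ Set.Icc lo hi) (ρ : ℕ → ℝ) :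
    ResponsePath lo hi N ρ (fun n => overshoot (ρ n) (z (n + 1) - z n)) z where
  mem := hz
  nonneg _ _ := by grind [overshoot]
  up _ _ _ := by grind [overshoot]
  down _ _ _ := by grind [overshoot]

namespace Model

variable {M : Model}

/-- The standing assumptions on the data. -/
structure Valid (M : Model) : Prop where
  T_pos : 0 < M.T
  E_pos : 0 < M.E
  R_pos : 0 < M.R
  P_pos : 0 < M.P
  ηc_pos : 0 < M.ηc
  ηd_pos : 0 < M.ηd
  θ_nonneg : 0 ≤ M.θ
  π_nonneg : 0 ≤ M.π
  limits : M.eLo ≤ M.eHi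
  capacity : M.eHi - M.eLo ≤ M.E
  Φ_zero : M.Φ 0 = 0
  Φ_nonneg : ∀ x ∈ Set.Icc (0 : ℝ) 1, 0 ≤ M.Φ x
  Φ_convex : StrictConvexOn ℝ (Set.Icc (0 : ℝ) 1) M.Φ

/-- The thresholds `u`, `v`, `w` minimize the costs of full, charge half and discharge half
cycles. -/
structure Thresholds (M : Model) (u v w : ℝ) : Prop where
  u_mem : u ∈ Set.Icc (0 : ℝ) 1
  u_min : IsMinOn M.Ju (Set.Icc (0 : ℝ) 1) u
  v_mem : v ∈ Set.Icc (0 : ℝ) 1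
  v_min : IsMinOn M.Jv (Set.Icc (0 : ℝ) 1) v
  w_mem : w ∈ Set.Icc (0 : ℝ) 1
  w_min : IsMinOn M.Jw (Set.Icc (0 : ℝ) 1) w

/-! ### Energy steps and levels -/

/-- The change of the stored energy over one interval at signed power `s`, where `s > 0` charges
the battery. -/
def energyStep (M : Model) (s : ℝ) : ℝ := M.T * M.ηc * max s 0 - M.T / M.ηd * max (-s) 0

theorem energyStep_of_nonneg {s : ℝ} (hs : 0 ≤ s) : M.energyStep s = M.T * M.ηc * s := by
  rw [energyStep, max_eq_left hs, max_eq_right (neg_nonpos.2 hs), mul_zero, sub_zero]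

theorem energyStep_of_nonpos {s : ℝ} (hs : s ≤ 0) : M.energyStep s = M.T / M.ηd * s := by
  rw [energyStep, max_eq_right hs, max_eq_left (neg_nonneg.2 hs), mul_zero, zero_sub, mul_neg,
    neg_neg]

theorem energyStep_zero : M.energyStep 0 = 0 := by rw [energyStep_of_nonneg le_rfl, mul_zero]

theorem energyStep_strictMono (hM : M.Valid) : StrictMono M.energyStep := by
  have hc := mul_pos hM.T_pos hM.ηc_pos
  have hd := div_pos hM.T_pos hM.ηd_pos
  intro a b hab
  rcases le_or_gt 0 a with ha | ha
  · rw [energyStep_of_nonneg ha, energyStep_of_nonneg (ha.trans hab.le)]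
    gcongr
  rcases le_total b 0 with hb | hb
  · rw [energyStep_of_nonpos ha.le, energyStep_of_nonpos hb]
    gcongr
  · rw [energyStep_of_nonpos ha.le, energyStep_of_nonneg hb]
    exact (mul_neg_of_pos_of_neg hd ha).trans_le (mul_nonneg hc.le hb)

theorem energyStep_surjective (hM : M.Valid) : Function.Surjective M.energyStep := by
  have hc := mul_pos hM.T_pos hM.ηc_pos
  have hd := div_pos hM.T_pos hM.ηd_pos
  intro ξ
  rcases le_total 0 ξ with hξ | hξ
  · refine ⟨ξ / (M.T * M.ηc), ?_⟩
    rw [energyStep_of_nonneg (div_nonneg hξ hc.le), mul_div_cancel₀ ξ hc.ne']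
  · refine ⟨ξ / (M.T / M.ηd), ?_⟩
    rw [energyStep_of_nonpos (div_nonpos_of_nonpos_of_nonneg hξ hd.le), mul_div_cancel₀ ξ hd.ne']

theorem energyStep_of_lossless (hη : M.ηc * M.ηd = 1) (s : ℝ) :
    M.energyStep s = M.T * M.ηc * s := by
  have hd : M.T / M.ηd = M.T * M.ηc := by
    rw [eq_inv_of_mul_eq_one_left hη, div_eq_mul_inv]
  rw [energyStep, hd, ← mul_sub]
  grind

theorem soc_eq_add (M : Model) (e₀ : ℝ) (c d : ℕ → ℝ) (n : ℕ) :
    M.soc e₀ c d n = e₀ + M.soc 0 c d n := by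
  induction n with
  | zero => simp [soc]
  | succ n ih => rw [soc, soc, ih]; ring

/-- The stored energy relative to its initial value, in units of the capacity. -/
def level (M : Model) (x : (ℕ → ℝ) × (ℕ → ℝ)) (n : ℕ) : ℝ := M.soc 0 x.1 x.2 n / M.E

theorem level_zero (x : (ℕ → ℝ) × (ℕ → ℝ)) : M.level x 0 = 0 := zero_div _

theorem level_eq_soc_sub_div (x : (ℕ → ℝ) × (ℕ → ℝ)) (e₀ : ℝ) (n : ℕ) :
    M.level x n = (M.soc e₀ x.1 x.2 n - e₀) / M.E := by
  rw [soc_eq_add, add_sub_cancel_left, level]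

section Feasible

variable {N : ℕ} {e₀ : ℝ} {r : ℕ → ℝ} {x : (ℕ → ℝ) × (ℕ → ℝ)}

theorem level_mem (hM : M.Valid) (hx : x ∈ M.feasible N e₀) :
    ∀ n ≤ N, M.level x n ∈ Set.Icc ((M.eLo - e₀) / M.E) ((M.eHi - e₀) / M.E) := by
  intro n hn
  have hE := hM.E_pos
  obtain ⟨hlo, hhi⟩ := hx.1 n hn
  rw [level_eq_soc_sub_div x e₀]
  exact ⟨by gcongr, by gcongr⟩

theorem energyStep_sub_of_feasible (hx : x ∈ M.feasible N e₀) {n : ℕ} (hn : n < N) :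
    M.energyStep (x.1 n - x.2 n) = M.T * M.ηc * x.1 n - M.T / M.ηd * x.2 n := by
  obtain ⟨⟨hc, -⟩, ⟨hd, -⟩, h | h⟩ := hx.2 n hn
  · rw [h, zero_sub, energyStep_of_nonpos (neg_nonpos.2 hd)]
    ring
  · rw [h, sub_zero, energyStep_of_nonneg hc]
    ring

theorem level_succ_sub (hx : x ∈ M.feasible N e₀) {n : ℕ} (hn : n < N) :
    M.level x (n + 1) - M.level x n = M.energyStep (x.1 n - x.2 n) / M.E := by
  rw [energyStep_sub_of_feasible hx hn, level, level, ← sub_div, soc, add_sub_cancel_left]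

theorem sub_mem_uIcc_of_responsive (hx : x ∈ M.responsive N e₀ r) {n : ℕ} (hn : n < N) :
    x.1 n - x.2 n ∈ Set.uIcc 0 (r n) := by
  have hpower := hx.1.2 n hn
  have hresp := hx.2 n hn
  simp only [Set.mem_Icc, Set.mem_uIcc] at *
  grind

theorem level_sub_mem_uIcc_of_responsive (hM : M.Valid) (hx : x ∈ M.responsive N e₀ r) {n : ℕ}
    (hn : n < N) :
    M.level x (n + 1) - M.level x n ∈ Set.uIcc 0 (M.energyStep (r n) / M.E) := by
  have hmono : Monotone fun s => M.energyStep s / M.E :=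
    (energyStep_strictMono hM).monotone.div_const hM.E_pos.le
  rw [level_succ_sub hx.1 hn]
  simpa only [energyStep_zero, zero_div] using
    hmono.mapsTo_uIcc (sub_mem_uIcc_of_responsive hx hn)

end Feasible

/-! ### Costs in terms of strokes -/

theorem sum_map_mul_sub (l : List ℝ) (φ : ℝ → ℝ) (k m : ℝ) :
    (l.map fun x => k * φ x - m * x).sum = k * (l.map φ).sum - m * l.sum := by
  induction l with
  | nil => simp
  | cons a l ih => simp only [List.map_cons, List.sum_cons, ih]; ring

theorem Jv_eq (M : Model) (x : ℝ) :
    M.Jv x = M.E * M.R * (M.Φ x / 2) - M.E / M.ηc * M.θ * x := by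
  rw [Jv]; ring

theorem Jw_eq (M : Model) (x : ℝ) :
    M.Jw x = M.E * M.R * (M.Φ x / 2) - M.E * M.ηd * M.π * x := by
  rw [Jw]; ring

/-- The penalty of not responding at all. -/
def baseline (M : Model) (N : ℕ) (r : ℕ → ℝ) : ℝ :=
  ∑ n ∈ Finset.range N, (M.T * M.θ * max (r n) 0 + M.T * M.π * max (-r n) 0)

section

variable {N : ℕ} {e₀ : ℝ} {r : ℕ → ℝ} {x : (ℕ → ℝ) × (ℕ → ℝ)}

theorem agingCost_eq_strokeCost_add (hM : M.Valid) (hx : x ∈ M.feasible N e₀) :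
    M.agingCost N x.1 x.2 = strokeCost M.Jv M.Jw (profileOf N (M.level x)) +
      M.E / M.ηc * M.θ * ∑ n ∈ Finset.range N, max (M.level x (n + 1) - M.level x n) 0 +
      M.E * M.ηd * M.π * ∑ n ∈ Finset.range N, max (M.level x n - M.level x (n + 1)) 0 := by
  have hlimits : (M.eLo - e₀) / M.E ≤ (M.eHi - e₀) / M.E := by
    have := hM.E_pos
    have := hM.limits
    gcongr
  have hprofile : M.profile N x.1 x.2 = profileOf N (M.level x) := rfl
  have hlevel := level_mem hM hx
  simp only [agingCost, hprofile, strokeCost, funext M.Jv_eq, funext M.Jw_eq,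
    sum_map_mul_sub _ (fun x => M.Φ x / 2), sum_ups_profileOf hlimits hlevel,
    sum_downs_profileOf hlimits hlevel, lifeLoss_eq_sum_ups_add_sum_downs]
  ring

theorem mul_max_energyStep_div (hM : M.Valid) (s : ℝ) :
    M.E / M.ηc * M.θ * max (M.energyStep s / M.E) 0 = M.T * M.θ * max s 0 := by
  have hE := hM.E_pos
  have hT := hM.T_pos
  have hc := hM.ηc_pos
  have hd := hM.ηd_pos
  rcases le_total 0 s with hs | hs
  · rw [energyStep_of_nonneg hs, max_eq_left hs, max_eq_left (by positivity)]
    field_simp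
  · rw [energyStep_of_nonpos hs, max_eq_right hs, max_eq_right, mul_zero, mul_zero]
    exact div_nonpos_of_nonpos_of_nonneg (mul_nonpos_of_nonneg_of_nonpos (by positivity) hs) hE.le

theorem mul_max_neg_energyStep_div (hM : M.Valid) (s : ℝ) :
    M.E * M.ηd * M.π * max (-(M.energyStep s / M.E)) 0 = M.T * M.π * max (-s) 0 := by
  have hE := hM.E_pos
  have hT := hM.T_pos
  have hc := hM.ηc_pos
  have hd := hM.ηd_pos
  rcases le_total 0 s with hs | hs
  · rw [energyStep_of_nonneg hs, max_eq_right (neg_nonpos.2 hs), max_eq_right, mul_zero, mul_zero]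
    exact neg_nonpos.2 (by positivity)
  · rw [energyStep_of_nonpos hs, max_eq_left (neg_nonneg.2 hs), max_eq_left]
    · field_simp
    · exact neg_nonneg.2 (div_nonpos_of_nonpos_of_nonneg
        (mul_nonpos_of_nonneg_of_nonpos (by positivity) hs) hE.le)

/-- The costs of half cycles are net of the penalties that moving in their direction avoids. -/
theorem cost_eq (hM : M.Valid) (hx : x ∈ M.feasible N e₀) (r : ℕ → ℝ) :
    M.cost N r x = strokeCost M.Jv M.Jw (profileOf N (M.level x)) + M.baseline N r +
      M.T * (M.θ + M.π) * ∑ n ∈ Finset.range N, overshoot (r n) (x.1 n - x.2 n) := by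
  rw [cost, agingCost_eq_strokeCost_add hM hx, penalty, baseline]
  simp only [Finset.mul_sum, add_assoc, ← Finset.sum_add_distrib]
  congr 1
  refine Finset.sum_congr rfl fun n hn => ?_
  rw [← neg_sub (M.level x (n + 1)), level_succ_sub hx (Finset.mem_range.1 hn),
    mul_max_energyStep_div hM, mul_max_neg_energyStep_div hM, sub_add]
  linear_combination M.T * M.θ * max_add_max_sub (r n) (x.1 n - x.2 n) +
    M.T * M.π * max_neg_add_max_sub (r n) (x.1 n - x.2 n)

theorem cost_eq_of_responsive (hM : M.Valid) (hx : x ∈ M.responsive N e₀ r) :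
    M.cost N r x = strokeCost M.Jv M.Jw (profileOf N (M.level x)) + M.baseline N r := by
  rw [cost_eq hM hx.1, Finset.sum_eq_zero fun n hn => overshoot_eq_zero
    (sub_mem_uIcc_of_responsive hx (Finset.mem_range.1 hn)), mul_zero, add_zero]

/-- The total amount by which the levels overshoot the instructed steps. -/
def levelOvershoot (M : Model) (N : ℕ) (r : ℕ → ℝ) (x : (ℕ → ℝ) × (ℕ → ℝ)) : ℝ :=
  ∑ n ∈ Finset.range N, overshoot (M.energyStep (r n) / M.E) (M.level x (n + 1) - M.level x n)

theorem levelOvershoot_of_responsive (hM : M.Valid) (hx : x ∈ M.responsive N e₀ r) :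
    M.levelOvershoot N r x = 0 :=
  Finset.sum_eq_zero fun _ hn => overshoot_eq_zero
    (level_sub_mem_uIcc_of_responsive hM hx (Finset.mem_range.1 hn))

theorem levelOvershoot_of_lossless (hM : M.Valid) (hη : M.ηc * M.ηd = 1)
    (hx : x ∈ M.feasible N e₀) (r : ℕ → ℝ) :
    (M.E / M.ηc * M.θ + M.E * M.ηd * M.π) * M.levelOvershoot N r x =
      M.T * (M.θ + M.π) * ∑ n ∈ Finset.range N, overshoot (r n) (x.1 n - x.2 n) := by
  have hE := hM.E_pos
  have hc := hM.ηc_pos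
  have hk : 0 ≤ M.T * M.ηc / M.E := div_nonneg (mul_pos hM.T_pos hc).le hE.le
  have hlevel : M.levelOvershoot N r x =
      M.T * M.ηc / M.E * ∑ n ∈ Finset.range N, overshoot (r n) (x.1 n - x.2 n) := by
    rw [Finset.mul_sum]
    refine Finset.sum_congr rfl fun n hn => ?_
    rw [level_succ_sub hx (Finset.mem_range.1 hn), energyStep_of_lossless hη,
      energyStep_of_lossless hη, ← overshoot_mul hk]
    congr 1 <;> ring
  rw [hlevel, eq_inv_of_mul_eq_one_right hη]
  field_simp

end

/-! ### The threshold policy as a path -/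

section Policy

variable {u e₀ : ℝ} {r : ℕ → ℝ}

theorem policyState_e (M : Model) (u e₀ : ℝ) (r : ℕ → ℝ) (n : ℕ) :
    (M.policyState u e₀ r n).e = M.soc e₀ (M.policy u e₀ r).1 (M.policy u e₀ r).2 n := by
  induction n with
  | zero => rfl
  | succ n ih => rw [soc, ← ih]; rfl

theorem policyState_e_succ_of_nonneg (hM : M.Valid) {n : ℕ} (hr : 0 ≤ r n) :
    (M.policyState u e₀ r (n + 1)).e =
      min (min M.eHi ((M.policyState u e₀ r n).eMin + u * M.E))
        ((M.policyState u e₀ r n).e + M.energyStep (r n)) := by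
  have hk := mul_pos hM.T_pos hM.ηc_pos
  simp only [policyState, policyAction, if_pos hr, energyStep_of_nonneg hr, mul_zero, sub_zero]
  rw [mul_min_of_nonneg _ _ hk.le, ← min_add_add_left, ← mul_assoc, mul_one_div_cancel hk.ne',
    one_mul, add_sub_cancel]

theorem policyState_e_succ_of_neg (hM : M.Valid) {n : ℕ} (hr : r n < 0) :
    (M.policyState u e₀ r (n + 1)).e =
      max (max M.eLo ((M.policyState u e₀ r n).eMax - u * M.E))
        ((M.policyState u e₀ r n).e + M.energyStep (r n)) := by
  have hT := hM.T_pos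
  have hd := hM.ηd_pos
  simp only [policyState, policyAction, if_neg hr.not_ge, energyStep_of_nonpos hr.le, mul_zero,
    zero_sub]
  rw [mul_min_of_nonneg _ _ (div_pos hT hd).le, ← max_neg_neg, ← max_add_add_left, ← mul_assoc,
    div_mul_div_cancel₀ hd.ne', div_self hT.ne', mul_neg, neg_neg, one_mul, neg_sub,
    add_sub_cancel]

theorem policyState_mem (M : Model) (u e₀ : ℝ) (r : ℕ → ℝ) {j n : ℕ} (hj : j ≤ n) :
    (M.policyState u e₀ r j).e ∈
      Set.Icc (M.policyState u e₀ r n).eMin (M.policyState u e₀ r n).eMax := by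
  induction n, hj using Nat.le_induction with
  | base => cases j <;> simp [policyState]
  | succ n _ ih => exact ⟨(min_le_left _ _).trans ih.1, ih.2.trans (le_max_left _ _)⟩

theorem exists_policyState_eq_eMin (M : Model) (u e₀ : ℝ) (r : ℕ → ℝ) (n : ℕ) :
    ∃ j ≤ n, (M.policyState u e₀ r j).e = (M.policyState u e₀ r n).eMin := by
  induction n with
  | zero => exact ⟨0, le_rfl, rfl⟩
  | succ n ih =>
    obtain ⟨j, hj, h⟩ := ih
    rcases min_choice (M.policyState u e₀ r n).eMin (M.policyState u e₀ r (n + 1)).e with h' | h'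
    · exact ⟨j, by omega, h.trans h'.symm⟩
    · exact ⟨n + 1, le_rfl, h'.symm⟩

theorem exists_policyState_eq_eMax (M : Model) (u e₀ : ℝ) (r : ℕ → ℝ) (n : ℕ) :
    ∃ j ≤ n, (M.policyState u e₀ r j).e = (M.policyState u e₀ r n).eMax := by
  induction n with
  | zero => exact ⟨0, le_rfl, rfl⟩
  | succ n ih =>
    obtain ⟨j, hj, h⟩ := ih
    rcases max_choice (M.policyState u e₀ r n).eMax (M.policyState u e₀ r (n + 1)).e with h' | h'
    · exact ⟨j, by omega, h.trans h'.symm⟩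
    · exact ⟨n + 1, le_rfl, h'.symm⟩

theorem policyState_bounds (hM : M.Valid) (hu : 0 ≤ u) (he : e₀ ∈ Set.Icc M.eLo M.eHi)
    (r : ℕ → ℝ) (n : ℕ) :
    M.eLo ≤ (M.policyState u e₀ r n).eMin ∧ (M.policyState u e₀ r n).eMax ≤ M.eHi ∧
      (M.policyState u e₀ r n).eMax - (M.policyState u e₀ r n).eMin ≤ u * M.E := by
  have hmono := (energyStep_strictMono hM).monotone
  have huE := mul_nonneg hu hM.E_pos.le
  induction n with
  | zero => exact ⟨he.1, he.2, by simpa [policyState] using huE⟩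
  | succ n ih =>
    have hmem := policyState_mem M u e₀ r (le_refl n)
    have eMin_succ : (M.policyState u e₀ r (n + 1)).eMin =
      min (M.policyState u e₀ r n).eMin (M.policyState u e₀ r (n + 1)).e := rfl
    have eMax_succ : (M.policyState u e₀ r (n + 1)).eMax =
      max (M.policyState u e₀ r n).eMax (M.policyState u e₀ r (n + 1)).e := rfl
    rcases le_or_gt 0 (r n) with hr | hr
    · have hstep : 0 ≤ M.energyStep (r n) := energyStep_zero (M := M) ▸ hmono hr
      have := policyState_e_succ_of_nonneg (u := u) (e₀ := e₀) hM hr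
      grind
    · have hstep : M.energyStep (r n) ≤ 0 := energyStep_zero (M := M) ▸ hmono hr.le
      have := policyState_e_succ_of_neg (u := u) (e₀ := e₀) hM hr
      grind

theorem policy_mem_Icc (hM : M.Valid) (hu : 0 ≤ u) (he : e₀ ∈ Set.Icc M.eLo M.eHi)
    (r : ℕ → ℝ) (n : ℕ) :
    (M.policy u e₀ r).1 n ∈ Set.Icc 0 (max (r n) 0) ∧
      (M.policy u e₀ r).2 n ∈ Set.Icc 0 (max (-r n) 0) := by
  obtain ⟨hlo, hhi, hrange⟩ := policyState_bounds hM hu he r n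
  obtain ⟨hmin, hmax⟩ := policyState_mem M u e₀ r (le_refl n)
  have hT := hM.T_pos
  have hc := hM.ηc_pos
  have hd := hM.ηd_pos
  simp only [policy, policyAction]
  split_ifs with hr
  · refine ⟨⟨le_min (mul_nonneg (by positivity) ?_) hr, (min_le_right _ _).trans (le_max_left _ _)⟩,
      le_rfl, le_max_right _ _⟩
    grind
  · refine ⟨⟨le_rfl, le_max_right _ _⟩, le_min (mul_nonneg (by positivity) ?_) (by linarith),
      (min_le_right _ _).trans (le_max_left _ _)⟩
    grind

theorem policy_mem_responsive (hM : M.Valid) (hu : 0 ≤ u) (he : e₀ ∈ Set.Icc M.eLo M.eHi)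
    {N : ℕ} (hr : ∀ n < N, r n ∈ Set.Icc (-M.P) M.P) :
    M.policy u e₀ r ∈ M.responsive N e₀ r := by
  have action := policy_mem_Icc hM hu he r
  refine ⟨⟨fun n _ => ?_, fun n hn => ?_⟩, fun n _ => ⟨(action n).1.2, (action n).2.2⟩⟩
  · obtain ⟨hlo, hhi, -⟩ := policyState_bounds hM hu he r n
    rw [← policyState_e]
    exact Set.Icc_subset_Icc hlo hhi (policyState_mem M u e₀ r le_rfl)
  · obtain ⟨⟨c₀, c₁⟩, d₀, d₁⟩ := action n
    obtain ⟨r₀, r₁⟩ := hr n hn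
    refine ⟨⟨c₀, by grind [hM.P_pos]⟩, ⟨d₀, by grind [hM.P_pos]⟩, ?_⟩
    grind

theorem thresholdPath_policyState (hM : M.Valid) (hu : 0 ≤ u) (he : e₀ ∈ Set.Icc M.eLo M.eHi)
    (N : ℕ) (r : ℕ → ℝ) :
    ThresholdPath (u * M.E) M.eLo M.eHi N (fun n => M.energyStep (r n))
      fun n => (M.policyState u e₀ r n).e where
  mem n _ := by
    obtain ⟨hlo, hhi, -⟩ := policyState_bounds hM hu he r n
    exact Set.Icc_subset_Icc hlo hhi (policyState_mem M u e₀ r le_rfl)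
  range i hi j hj := by
    obtain ⟨-, -, hrange⟩ := policyState_bounds hM hu he r N
    linarith [(policyState_mem M u e₀ r hi).2, (policyState_mem M u e₀ r hj).1]
  up n _ hρ := by
    have hr : 0 ≤ r n := (energyStep_strictMono hM).le_iff_le.1 (energyStep_zero.trans_le hρ)
    obtain ⟨-, hhi, hrange⟩ := policyState_bounds hM hu he r n
    have hmem := policyState_mem M u e₀ r (le_refl n)
    obtain ⟨j, hj, hjmin⟩ := exists_policyState_eq_eMin M u e₀ r n
    have := policyState_e_succ_of_nonneg (u := u) (e₀ := e₀) hM hr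
    grind
  down n _ hρ := by
    have hr : r n ≤ 0 := (energyStep_strictMono hM).le_iff_le.1 (hρ.trans_eq energyStep_zero.symm)
    obtain ⟨hlo, hhi, hrange⟩ := policyState_bounds hM hu he r n
    have hmem := policyState_mem M u e₀ r (le_refl n)
    rcases hr.lt_or_eq with hr | hr
    · obtain ⟨j, hj, hjmax⟩ := exists_policyState_eq_eMax M u e₀ r n
      have := policyState_e_succ_of_neg (u := u) (e₀ := e₀) hM hr
      grind
    · have := mul_nonneg hu hM.E_pos.le
      have hstep : M.energyStep (r n) = 0 := by rw [hr, energyStep_zero]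
      have := policyState_e_succ_of_nonneg (u := u) (e₀ := e₀) hM hr.ge
      grind

theorem thresholdPath_policy (hM : M.Valid) (hu : 0 ≤ u) (he : e₀ ∈ Set.Icc M.eLo M.eHi)
    (N : ℕ) (r : ℕ → ℝ) :
    ThresholdPath u ((M.eLo - e₀) / M.E) ((M.eHi - e₀) / M.E) N
      (fun n => M.energyStep (r n) / M.E) (M.level (M.policy u e₀ r)) := by
  simpa only [policyState_e, ← level_eq_soc_sub_div] using
    (thresholdPath_policyState hM hu he N r).rescale hM.E_pos e₀

end Policy

/-! ### The upper bound -/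

theorem Jv_strictConvexOn (hM : M.Valid) : StrictConvexOn ℝ (Set.Icc (0 : ℝ) 1) M.Jv := by
  convert strictConvexOn_mul_sub_linear hM.Φ_convex
    (mul_pos one_half_pos (mul_pos hM.E_pos hM.R_pos)) (M.E / M.ηc * M.θ) using 1
  funext x
  rw [Jv]; ring

theorem Jw_strictConvexOn (hM : M.Valid) : StrictConvexOn ℝ (Set.Icc (0 : ℝ) 1) M.Jw := by
  convert strictConvexOn_mul_sub_linear hM.Φ_convex
    (mul_pos one_half_pos (mul_pos hM.E_pos hM.R_pos)) (M.E * M.ηd * M.π) using 1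
  funext x
  rw [Jw]; ring

theorem Jv_zero (hM : M.Valid) : M.Jv 0 = 0 := by simp [Jv, hM.Φ_zero]

theorem Jw_zero (hM : M.Valid) : M.Jw 0 = 0 := by simp [Jw, hM.Φ_zero]

theorem neg_le_Jv (hM : M.Valid) : ∀ t ∈ Set.Icc (0 : ℝ) 1, -(M.E / M.ηc * M.θ * t) ≤ M.Jv t := by
  intro t ht
  have := mul_nonneg (mul_pos hM.E_pos hM.R_pos).le (hM.Φ_nonneg t ht)
  rw [Jv]
  linarith

theorem neg_le_Jw (hM : M.Valid) : ∀ t ∈ Set.Icc (0 : ℝ) 1, -(M.E * M.ηd * M.π * t) ≤ M.Jw t := by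
  intro t ht
  have := mul_nonneg (mul_pos hM.E_pos hM.R_pos).le (hM.Φ_nonneg t ht)
  rw [Jw]
  linarith

theorem Jv_add_Jw (M : Model) (x : ℝ) : M.Jv x + M.Jw x = M.Ju x := by
  rw [Jv, Jw, Ju]; ring

theorem Jv_eq_Jw_add (M : Model) (x : ℝ) :
    M.Jv x = M.Jw x + M.E * (M.π * M.ηd - M.θ / M.ηc) * x := by
  rw [Jv, Jw]; ring

section Thresholds

variable {u v w : ℝ} (hM : M.Valid) (h : M.Thresholds u v w)

include hM h

theorem Thresholds.strokePrices_of_le (hθπ : M.θ / M.ηc ≤ M.π * M.ηd) :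
    StrokePrices M.Jv M.Jw u v w :=
  .of_add_linear (Jv_strictConvexOn hM) (Jw_strictConvexOn hM) (Jv_zero hM) (Jw_zero hM)
    (mul_nonneg hM.E_pos.le (sub_nonneg.2 hθπ)) M.Jv_eq_Jw_add h.u_mem h.v_mem h.w_mem
    (by simpa only [Jv_add_Jw] using h.u_min) h.v_min h.w_min

theorem Thresholds.strokePrices_of_ge (hθπ : M.π * M.ηd ≤ M.θ / M.ηc) :
    StrokePrices M.Jw M.Jv u w v :=
  .of_add_linear (Jw_strictConvexOn hM) (Jv_strictConvexOn hM) (Jw_zero hM) (Jv_zero hM)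
    (mul_nonneg hM.E_pos.le (sub_nonneg.2 hθπ)) (fun x => by rw [Jv_eq_Jw_add]; ring) h.u_mem
    h.w_mem h.v_mem (by simpa only [add_comm (M.Jw _), Jv_add_Jw] using h.u_min) h.w_min h.v_min

theorem Thresholds.eq_of_eq (hθπ : M.θ / M.ηc = M.π * M.ηd) : v = u ∧ w = u := by
  have hle := h.strokePrices_of_le hM hθπ.le
  have hge := h.strokePrices_of_ge hM hθπ.ge
  exact ⟨hle.le_left.antisymm hge.le_right, hge.le_left.antisymm hle.le_right⟩

theorem Thresholds.worstGap_of_le (hθπ : M.θ / M.ηc ≤ M.π * M.ηd) :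
    M.worstGap u v w = 2 * (M.Jv u - M.Jv v) + (M.Jw u - M.Jw w) := by
  rcases hθπ.lt_or_eq with hlt | heq
  · rw [worstGap, if_pos hlt]
    ring
  · obtain ⟨rfl, rfl⟩ := h.eq_of_eq hM heq
    rw [worstGap, if_neg heq.not_lt, if_neg heq.not_gt]
    ring

theorem Thresholds.worstGap_of_ge (hθπ : M.π * M.ηd ≤ M.θ / M.ηc) :
    M.worstGap u v w = 2 * (M.Jw u - M.Jw w) + (M.Jv u - M.Jv v) := by
  rcases hθπ.lt_or_eq with hlt | heq
  · rw [worstGap, if_neg hlt.not_gt, if_pos hlt]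
    ring
  · obtain ⟨rfl, rfl⟩ := h.eq_of_eq hM heq.symm
    rw [worstGap, if_neg heq.not_gt, if_neg heq.not_lt]
    ring

variable {N : ℕ} {e₀ : ℝ} {r : ℕ → ℝ} {x : (ℕ → ℝ) × (ℕ → ℝ)} (he : e₀ ∈ Set.Icc M.eLo M.eHi)

include he

theorem strokeCost_policy_le (hx : x ∈ M.feasible N e₀) :
    strokeCost M.Jv M.Jw (profileOf N (M.level (M.policy u e₀ r))) ≤
      strokeCost M.Jv M.Jw (profileOf N (M.level x)) +
        (M.E / M.ηc * M.θ + M.E * M.ηd * M.π) * M.levelOvershoot N r x + M.worstGap u v w := by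
  have hE := hM.E_pos
  have hKv : 0 ≤ M.E / M.ηc * M.θ := mul_nonneg (div_pos hE hM.ηc_pos).le hM.θ_nonneg
  have hKw : 0 ≤ M.E * M.ηd * M.π := mul_nonneg (mul_pos hE hM.ηd_pos).le hM.π_nonneg
  have hy := thresholdPath_policy hM h.u_mem.1 he N r
  have hz := responsePath_overshoot (level_mem hM hx) fun n => M.energyStep (r n) / M.E
  have hyz : M.level (M.policy u e₀ r) 0 = M.level x 0 := by rw [level_zero, level_zero]
  have hlimits : (M.eHi - e₀) / M.E - (M.eLo - e₀) / M.E ≤ 1 := by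
    rw [← sub_div, div_le_one hE]
    linarith [hM.capacity]
  rcases le_total (M.θ / M.ηc) (M.π * M.ηd) with hθπ | hθπ
  · rw [h.worstGap_of_le hM hθπ]
    exact hy.strokeCost_le hz hyz hlimits (h.strokePrices_of_le hM hθπ) hKv hKw (neg_le_Jv hM)
      (neg_le_Jw hM)
  · rw [h.worstGap_of_ge hM hθπ, ← strokeCost_neg M.Jw, ← strokeCost_neg M.Jw, ← profileOf_neg,
      ← profileOf_neg, add_comm (M.E / M.ηc * M.θ)]
    exact hy.neg.strokeCost_le hz.neg (congrArg Neg.neg hyz) (by linarith)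
      (h.strokePrices_of_ge hM hθπ) hKw hKv (neg_le_Jw hM) (neg_le_Jv hM)

theorem cost_policy_le (hr : ∀ n < N, r n ∈ Set.Icc (-M.P) M.P) (hx : x ∈ M.feasible N e₀)
    (hcost : M.cost N r x = strokeCost M.Jv M.Jw (profileOf N (M.level x)) + M.baseline N r +
      (M.E / M.ηc * M.θ + M.E * M.ηd * M.π) * M.levelOvershoot N r x) :
    M.cost N r (M.policy u e₀ r) - M.cost N r x ≤ M.worstGap u v w := by
  rw [hcost, cost_eq_of_responsive hM (policy_mem_responsive hM h.u_mem.1 he hr)]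
  linarith [strokeCost_policy_le hM h he (r := r) hx]

end Thresholds

section Gap

variable {u v w : ℝ} (hM : M.Valid) (h : M.Thresholds u v w)

include hM h

theorem boundsGap_responsive : M.BoundsGap u M.responsive (M.worstGap u v w) :=
  fun _ _ _ he hr _ hx => cost_policy_le hM h he hr hx.1 <| by
    rw [cost_eq_of_responsive hM hx, levelOvershoot_of_responsive hM hx, mul_zero, add_zero]

theorem boundsGap_feasible (hη : M.ηc * M.ηd = 1) :
    M.BoundsGap u (fun N e₀ _ => M.feasible N e₀) (M.worstGap u v w) :=
  fun _ _ r he hr _ hx => cost_policy_le hM h he hr hx <| by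
    rw [cost_eq hM hx, levelOvershoot_of_lossless hM hη hx]

end Gap

/-! ### The bound is attained -/

/-- The controls with signed power `s`, where `s n > 0` charges the battery. -/
def signedControls (s : ℕ → ℝ) : (ℕ → ℝ) × (ℕ → ℝ) := (fun n => max (s n) 0, fun n => max (-s n) 0)

theorem level_signedControls_succ (M : Model) (s : ℕ → ℝ) (n : ℕ) :
    M.level (signedControls s) (n + 1) = M.level (signedControls s) n + M.energyStep (s n) / M.E :=
  add_div _ _ _

theorem level_signedControls_eq {s z : ℕ → ℝ} (z0 : z 0 = 0)
    (hz : ∀ n, M.energyStep (s n) / M.E = z (n + 1) - z n) : M.level (signedControls s) = z := by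
  funext n
  induction n with
  | zero => rw [level_zero, z0]
  | succ n ih => rw [level_signedControls_succ, ih, hz, add_sub_cancel]

theorem signedControls_mem_responsive (hM : M.Valid) {N : ℕ} {e₀ : ℝ} {r s : ℕ → ℝ}
    (hr : ∀ n, r n ∈ Set.Icc (-M.P) M.P) (hs : ∀ n, s n ∈ Set.uIcc 0 (r n))
    (hlevel : ∀ n ≤ N, M.level (signedControls s) n ∈
      Set.Icc ((M.eLo - e₀) / M.E) ((M.eHi - e₀) / M.E)) :
    signedControls s ∈ M.responsive N e₀ r := by
  refine ⟨⟨fun n hn => ?_, fun n _ => ?_⟩, fun n _ => ?_⟩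
  · have := hlevel n hn
    rw [level_eq_soc_sub_div _ e₀] at this
    simpa only [Set.mem_Icc, div_le_div_iff_of_pos_right hM.E_pos, sub_le_sub_iff_right] using this
  · have := hr n
    have := hs n
    simp only [Set.mem_Icc, Set.mem_uIcc, signedControls] at *
    grind
  · have := hs n
    simp only [Set.mem_uIcc, signedControls] at *
    grind

theorem exists_responsive_level_eq (hM : M.Valid) {N : ℕ} {e₀ : ℝ} {ρ z : ℕ → ℝ}
    (hρ : ∀ n, ρ n ∈ Set.Icc (M.energyStep (-M.P) / M.E) (M.energyStep M.P / M.E)) (z0 : z 0 = 0)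
    (hz : ∀ n, z (n + 1) - z n ∈ Set.uIcc 0 (ρ n))
    (hmem : ∀ n ≤ N, z n ∈ Set.Icc ((M.eLo - e₀) / M.E) ((M.eHi - e₀) / M.E)) :
    ∃ r, (∀ n, r n ∈ Set.Icc (-M.P) M.P) ∧ (∀ n, M.energyStep (r n) / M.E = ρ n) ∧
      ∃ x ∈ M.responsive N e₀ r, M.level x = z := by
  have hE := hM.E_pos
  have hsurj : Function.Surjective fun s => M.energyStep s / M.E :=
    (Equiv.divRight₀ M.E hE.ne').surjective.comp (energyStep_surjective hM)
  let step : ℝ ≃o ℝ := ((energyStep_strictMono hM).div_const hE).orderIsoOfSurjective _ hsurj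
  have step_symm_zero : step.symm 0 = 0 := by
    rw [OrderIso.symm_apply_eq]
    exact (zero_div _).symm.trans (congrArg (· / M.E) energyStep_zero.symm)
  have hr (n) : step.symm (ρ n) ∈ Set.Icc (-M.P) M.P :=
    ⟨step.le_symm_apply.2 (hρ n).1, step.symm_apply_le.2 (hρ n).2⟩
  have hs (n) : step.symm (z (n + 1) - z n) ∈ Set.uIcc 0 (step.symm (ρ n)) := by
    simpa only [step_symm_zero] using step.symm.monotone.mapsTo_uIcc (hz n)
  have hlevel : M.level (signedControls fun n => step.symm (z (n + 1) - z n)) = z :=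
    level_signedControls_eq z0 fun n => step.apply_symm_apply _
  exact ⟨_, hr, fun n => step.apply_symm_apply _, _,
    signedControls_mem_responsive hM hr hs (by rwa [hlevel]), hlevel⟩

/-- The policy with threshold `u` costs `δ` more than some controls that respond within the
instruction, which need not be optimal. -/
def AttainsGap (M : Model) (u δ : ℝ) : Prop :=
  ∃ (N : ℕ) (e₀ : ℝ) (r : ℕ → ℝ) (x : (ℕ → ℝ) × (ℕ → ℝ)),
    e₀ ∈ Set.Icc M.eLo M.eHi ∧ (∀ n < N, r n ∈ Set.Icc (-M.P) M.P) ∧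
      x ∈ M.responsive N e₀ r ∧ M.cost N r (M.policy u e₀ r) - M.cost N r x = δ

theorem exists_thresholdPath_attainsGap (hM : M.Valid) {u : ℝ} (hu : 0 ≤ u) {N : ℕ} {e₀ : ℝ}
    (he : e₀ ∈ Set.Icc M.eLo M.eHi) {ρ z : ℕ → ℝ}
    (hρ : ∀ n, ρ n ∈ Set.Icc (M.energyStep (-M.P) / M.E) (M.energyStep M.P / M.E)) (z0 : z 0 = 0)
    (hz : ∀ n, z (n + 1) - z n ∈ Set.uIcc 0 (ρ n))
    (hmem : ∀ n ≤ N, z n ∈ Set.Icc ((M.eLo - e₀) / M.E) ((M.eHi - e₀) / M.E)) :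
    ∃ y, ThresholdPath u ((M.eLo - e₀) / M.E) ((M.eHi - e₀) / M.E) N ρ y ∧ y 0 = 0 ∧
      M.AttainsGap u (strokeCost M.Jv M.Jw (profileOf N y) -
        strokeCost M.Jv M.Jw (profileOf N z)) := by
  obtain ⟨r, hr, hrρ, x, hx, rfl⟩ := exists_responsive_level_eq hM hρ z0 hz hmem
  have hy := thresholdPath_policy hM hu he N r
  simp only [hrρ] at hy
  refine ⟨_, hy, level_zero _, N, e₀, r, x, he, fun n _ => hr n, hx, ?_⟩
  rw [cost_eq_of_responsive hM hx,
    cost_eq_of_responsive hM (policy_mem_responsive hM hu he fun n _ => hr n),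
    add_sub_add_right_eq_sub]

theorem exists_Icc_one_div_subset (hM : M.Valid) :
    ∃ K : ℕ, 0 < K ∧ Set.Icc (-(1 / K) : ℝ) (1 / K) ⊆
      Set.Icc (M.energyStep (-M.P) / M.E) (M.energyStep M.P / M.E) := by
  have hE := hM.E_pos
  have hmono := energyStep_strictMono hM
  have charge : 0 < M.energyStep M.P / M.E :=
    div_pos (energyStep_zero.symm.trans_lt (hmono hM.P_pos)) hE
  have discharge : 0 < -(M.energyStep (-M.P) / M.E) := neg_pos.2 <| div_neg_of_neg_of_pos
    ((hmono (neg_neg_of_pos hM.P_pos)).trans_eq energyStep_zero) hE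
  obtain ⟨K, hK⟩ := exists_nat_one_div_lt (lt_min charge discharge)
  obtain ⟨hcharge, hdischarge⟩ := lt_min_iff.1 hK
  refine ⟨K + 1, K.succ_pos, Set.Icc_subset_Icc ?_ ?_⟩ <;> push_cast <;> linarith

section Attained

variable {u v w : ℝ} (hM : M.Valid) (h : M.Thresholds u v w)

include hM h

theorem attainsGap_worstGap_of_le (hθπ : M.θ / M.ηc ≤ M.π * M.ηd)
    (hwide : (u + |w - v|) * M.E ≤ M.eHi - M.eLo) : M.AttainsGap u (M.worstGap u v w) := by
  have hE := hM.E_pos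
  have hp := h.strokePrices_of_le hM hθπ
  have huw := hp.le_right
  have hvw := hp.le_left.trans huw
  rw [abs_of_nonneg (sub_nonneg.2 hvw)] at hwide
  obtain ⟨K, hK, hKP⟩ := exists_Icc_one_div_subset hM
  set e₀ := M.eLo + (w - v) * M.E with he₀
  have hlo : (M.eLo - e₀) / M.E = v - w := by rw [he₀]; field_simp; ring
  have hhi : u ≤ (M.eHi - e₀) / M.E := by rw [le_div_iff₀ hE]; linarith
  have he : e₀ ∈ Set.Icc M.eLo M.eHi := by
    have := mul_nonneg (sub_nonneg.2 hvw) hE.le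
    have := mul_nonneg h.u_mem.1 hE.le
    constructor <;> linarith
  obtain ⟨y, hy, y0, hgap⟩ := exists_thresholdPath_attainsGap (N := 3 * K) hM h.u_mem.1 he
    (fun n => hKP (upDownUp_step_mem hK h.u_mem h.w_mem n)) upDownUp_zero
    (upDownUp_step_mem_uIcc hK h.v_mem.1 hp.le_left h.w_mem.1)
    fun n hn => by
      rw [hlo]
      exact Set.Icc_subset_Icc_right (hp.le_left.trans hhi) (upDownUp_mem hK h.v_mem.1 hvw hn)
  rw [hy.strokeCost_upDownUp hK h.u_mem.1 huw (by linarith) hhi y0 hp.left_zero hp.right_zero,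
    strokeCost_upDownUp hK h.v_mem.1 hvw hp.left_zero hp.right_zero] at hgap
  convert hgap using 1
  rw [h.worstGap_of_le hM hθπ]
  ring

theorem attainsGap_worstGap_of_ge (hθπ : M.π * M.ηd ≤ M.θ / M.ηc)
    (hwide : (u + |w - v|) * M.E ≤ M.eHi - M.eLo) : M.AttainsGap u (M.worstGap u v w) := by
  have hE := hM.E_pos
  have hp := h.strokePrices_of_ge hM hθπ
  have huv := hp.le_right
  have hwv := hp.le_left.trans huv
  rw [abs_of_nonpos (sub_nonpos.2 hwv)] at hwide
  obtain ⟨K, hK, hKP⟩ := exists_Icc_one_div_subset hM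
  set e₀ := M.eHi - (v - w) * M.E with he₀
  have hhi : (M.eHi - e₀) / M.E = v - w := by rw [he₀]; field_simp; ring
  have hlo : u ≤ -((M.eLo - e₀) / M.E) := by rw [← neg_div, le_div_iff₀ hE]; linarith
  have he : e₀ ∈ Set.Icc M.eLo M.eHi := by
    have := mul_nonneg (sub_nonneg.2 hwv) hE.le
    have := mul_nonneg h.u_mem.1 hE.le
    constructor <;> linarith
  obtain ⟨y, hy, y0, hgap⟩ := exists_thresholdPath_attainsGap (N := 3 * K)
    (ρ := fun n => -(upDownUp K u v (n + 1) - upDownUp K u v n)) (z := fun n => -upDownUp K w v n)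
    hM h.u_mem.1 he
    (fun n => hKP (Set.neg_mem_Icc_iff.2
      (by simpa only [neg_neg] using upDownUp_step_mem hK h.u_mem h.v_mem n)))
    (by rw [upDownUp_zero, neg_zero])
    (fun n => by
      have := upDownUp_step_mem_uIcc hK h.w_mem.1 hp.le_left h.v_mem.1 n
      rw [Set.mem_uIcc] at *
      grind)
    fun n hn => by
      have := upDownUp_mem hK h.w_mem.1 hwv hn
      rw [hhi]
      constructor <;> linarith [this.1, this.2, hp.le_left]
  have hy := hy.neg
  simp only [neg_neg] at hy
  rw [← strokeCost_neg M.Jw, ← strokeCost_neg M.Jw, ← profileOf_neg, ← profileOf_neg,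
    hy.strokeCost_upDownUp hK h.u_mem.1 huv (by linarith) hlo (by rw [y0, neg_zero]) hp.left_zero
      hp.right_zero, funext fun n => neg_neg (upDownUp K w v n),
    strokeCost_upDownUp hK h.w_mem.1 hwv hp.left_zero hp.right_zero] at hgap
  convert hgap using 1
  rw [h.worstGap_of_ge hM hθπ]
  ring

theorem attainsGap_worstGap
    (hwide : M.π * M.ηd ≠ M.θ / M.ηc → (u + |w - v|) * M.E ≤ M.eHi - M.eLo) :
    M.AttainsGap u (M.worstGap u v w) := by
  rcases lt_trichotomy (M.θ / M.ηc) (M.π * M.ηd) with hlt | heq | hgt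
  · exact attainsGap_worstGap_of_le hM h hlt.le (hwide hlt.ne')
  · have he : M.eLo ∈ Set.Icc M.eLo M.eHi := ⟨le_rfl, hM.limits⟩
    have hr : ∀ n < 0, (0 : ℝ) ∈ Set.Icc (-M.P) M.P := fun n hn => absurd hn n.not_lt_zero
    refine ⟨0, M.eLo, 0, _, he, hr, policy_mem_responsive hM h.u_mem.1 he hr, ?_⟩
    rw [sub_self, worstGap, if_neg heq.not_lt, if_neg heq.not_gt]
  · exact attainsGap_worstGap_of_ge hM h hgt.le (hwide hgt.ne)

theorem isGreatest_gaps (hwide : M.π * M.ηd ≠ M.θ / M.ηc → (u + |w - v|) * M.E ≤ M.eHi - M.eLo)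
    {A : ℕ → ℝ → (ℕ → ℝ) → Set ((ℕ → ℝ) × (ℕ → ℝ))}
    (hA : ∀ N e₀ r, M.responsive N e₀ r ⊆ A N e₀ r) (hbound : M.BoundsGap u A (M.worstGap u v w)) :
    IsGreatest (M.gaps u A) (M.worstGap u v w) := by
  constructor
  · obtain ⟨N, e₀, r, x, he, hr, hx, hgap⟩ := attainsGap_worstGap hM h hwide
    refine ⟨N, e₀, r, x, he, hr, hA _ _ _ hx, fun x' hx' => ?_, hgap.symm⟩
    have : _ ≤ _ := hgap ▸ hbound N e₀ r he hr x' hx'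
    exact (sub_le_sub_iff_left _).1 this
  · rintro δ ⟨N, e₀, r, x, he, hr, hx, -, rfl⟩
    exact hbound N e₀ r he hr x hx

end Attained

end Model

end BatteryRegulation

end

open BatteryRegulation in
theorem theorem2 (M : Model)
    (hT : 0 < M.T) (hE : 0 < M.E) (hR : 0 < M.R) (hP : 0 < M.P)
    (hηc : 0 < M.ηc) (hηd : 0 < M.ηd) (hθ : 0 ≤ M.θ) (hπ : 0 ≤ M.π)
    (he : M.eLo ≤ M.eHi) (hcap : M.eHi - M.eLo ≤ M.E)
    (hΦ_zero : M.Φ 0 = 0) (hΦ_nonneg : ∀ x ∈ Set.Icc (0 : ℝ) 1, 0 ≤ M.Φ x)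
    (hΦ : StrictConvexOn ℝ (Set.Icc (0 : ℝ) 1) M.Φ)
    (u v w : ℝ)
    (hu : u ∈ Set.Icc (0 : ℝ) 1) (hu_min : IsMinOn M.Ju (Set.Icc (0 : ℝ) 1) u)
    (hv : v ∈ Set.Icc (0 : ℝ) 1) (hv_min : IsMinOn M.Jv (Set.Icc (0 : ℝ) 1) v)
    (hw : w ∈ Set.Icc (0 : ℝ) 1) (hw_min : IsMinOn M.Jw (Set.Icc (0 : ℝ) 1) w) :
    -- against every control that responds within the instruction, for any efficiencies
    M.BoundsGap u M.responsive (M.worstGap u v w) ∧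
    -- the bound is attained if the energy range leaves room for the depths involved
    ((M.π * M.ηd ≠ M.θ / M.ηc → (u + |w - v|) * M.E ≤ M.eHi - M.eLo) →
      IsGreatest (M.gaps u M.responsive) (M.worstGap u v w)) ∧
    -- for a lossless battery, the same against every feasible control
    (M.ηc * M.ηd = 1 →
      M.BoundsGap u (fun N e₀ _ => M.feasible N e₀) (M.worstGap u v w) ∧
      ((M.π * M.ηd ≠ M.θ / M.ηc → (u + |w - v|) * M.E ≤ M.eHi - M.eLo) →
        IsGreatest (M.gaps u fun N e₀ _ => M.feasible N e₀) (M.worstGap u v w))) := by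
  have hM : M.Valid := ⟨hT, hE, hR, hP, hηc, hηd, hθ, hπ, he, hcap, hΦ_zero, hΦ_nonneg, hΦ⟩
  have h : M.Thresholds u v w := ⟨hu, hu_min, hv, hv_min, hw, hw_min⟩
  have h₁ := Model.boundsGap_responsive hM h
  refine ⟨h₁, fun hwide => Model.isGreatest_gaps hM h hwide (fun _ _ _ => subset_rfl) h₁,
    fun hη => ?_⟩
  have h₂ := Model.boundsGap_feasible hM h hη
  exact ⟨h₂, fun hwide => Model.isGreatest_gaps hM h hwide (fun _ _ _ _ hx => hx.1) h₂⟩
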